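/- Let $\hbar=1$. On $L^2(\mathbb{R},\mathbb{C})$ with inner product $\langle f,g\rangle=\int_{\mathbb{R}}\overline{f(x)}\,g(x)\,dx$, let $X$ be the position operator $(Xf)(x)=xf(x)$ with domain $\operatorname{dom}(X)=\{f\in L^2 : \int_{\mathbb R} x^2|f(x)|^2dx<\infty\}$, and let $P$ be the momentum operator $(Pf)(x)=-i f'(x)$ with domain $\operatorname{dom}(P)=\{f\in L^2 : f \text{ is absolutely continuous and } \int_{\mathbb R}|f'(x)|^2dx<\infty\}$. Let $H$ be the closure of the operator $X+P$ defined on $\operatorname{dom}(X)\cap\operatorname{dom}(P)$, and let $\Phi(x)=\pi^{-1/4}e^{-x^2/2}$ be the vacuum vector. Then $H$ is self-adjoint, it has a unique spectral resolution $\{E_\lambda\}_{\lambda\in\mathbb{R}}$ (a right-continuous resolution of the identity with $H=\int_{\mathbb R}\lambda\,dE_\lambda$), and for each $t\in\mathbb{R}$ the spectral integral $\int_{\mathbb R}e^{it\lambda}\,dE_\lambda$ defines a unique bounded operator $e^{itH}$ on $L^2(\mathbb{R},\mathbb{C})$. The vacuum characteristic function of $H$ is $$\langle \Phi, e^{itH}\Phi\rangle=e^{-t^2/2}\qquad\text{for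 all } t\in\mathbb{R},$$ and the underlying probability distribution is Gaussian: the measure $d\langle\Phi,E_\lambda\Phi\rangle$ on $\mathbb{R}$ is the Gaussian distribution with mean $0$ and variance $1$. -/

import Mathlib

open MeasureTheory Filter Topology
open scoped InnerProductSpace

noncomputable section

/-! ### Resolutions of the identity and spectral integrals -/

/-- A (right-continuous) resolution of the identity `(E_x)_{x ∈ ℝ}` on a Hilbert space. -/
structure ResolutionOfIdentity (V : Type*) [NormedAddCommGroup V] [InnerProductSpace ℂ V]
    [CompleteSpace V] where
  /-- The projection `E_x`. -/
  proj : ℝ → V →L[ℂ] V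
  isStarProjection : ∀ x, IsStarProjection (proj x)
  proj_mul_proj : ∀ x y, x ≤ y → proj x * proj y = proj x
  tendsto_right : ∀ x u, Tendsto (fun y => proj y u) (𝓝[>] x) (𝓝 (proj x u))
  tendsto_atBot : ∀ u, Tendsto (fun y => proj y u) atBot (𝓝 0)
  tendsto_atTop : ∀ u, Tendsto (fun y => proj y u) atTop (𝓝 u)

namespace ResolutionOfIdentity

variable {V : Type*} [NormedAddCommGroup V] [InnerProductSpace ℂ V] [CompleteSpace V]

theorem re_inner_proj (E : ResolutionOfIdentity V) (x : ℝ) (u : V) :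
    (⟪u, E.proj x u⟫_ℂ).re = ‖E.proj x u‖ ^ 2 := by
  have h := E.isStarProjection x
  have h1 : E.proj x u = E.proj x (E.proj x u) := by
    have := congrArg (fun T : V →L[ℂ] V => T u) h.isIdempotentElem.eq
    simpa using this.symm
  have h2 : ⟪u, E.proj x u⟫_ℂ = ⟪E.proj x u, E.proj x u⟫_ℂ := by
    conv_lhs => rw [h1]
    rw [← ContinuousLinearMap.adjoint_inner_left,
      ContinuousLinearMap.isSelfAdjoint_iff'.1 h.isSelfAdjoint]
  rw [h2, inner_self_eq_norm_sq_to_K]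
  norm_cast

/-- The non-decreasing right-continuous function `x ↦ ⟨u, E_x u⟩`. -/
def cdf (E : ResolutionOfIdentity V) (u : V) : StieltjesFunction ℝ where
  toFun x := (⟪u, E.proj x u⟫_ℂ).re
  mono' := by
    intro x y hxy
    simp only [re_inner_proj]
    have h1 : E.proj x u = E.proj x (E.proj y u) := by
      have := congrArg (fun T : V →L[ℂ] V => T u) (E.proj_mul_proj x y hxy)
      simpa using this.symm
    have h2 : ‖E.proj x u‖ ≤ ‖E.proj y u‖ := by
      have h3 := E.re_inner_proj x (E.proj y u)
      have h4 : (⟪E.proj y u, E.proj x (E.proj y u)⟫_ℂ).re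
          ≤ ‖E.proj y u‖ * ‖E.proj x (E.proj y u)‖ :=
        (Complex.re_le_norm _).trans (norm_inner_le_norm _ _)
      rw [h3, ← h1] at h4
      by_contra! hlt
      nlinarith [norm_nonneg (E.proj x u), norm_nonneg (E.proj y u)]
    gcongr
  right_continuous' x := by
    rw [continuousWithinAt_Ioi_iff_Ici.symm]
    exact (Complex.continuous_re.tendsto _).comp
      (tendsto_const_nhds.inner (E.tendsto_right x u))

/-- The measure `d⟨u, E_x u⟩` on `ℝ`. For a unit vector `u` this is the probability distribution,
in the state `u`, of the observable whose spectral resolution is `E`. -/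
def distribution (E : ResolutionOfIdentity V) (u : V) : Measure ℝ := (E.cdf u).measure

/-- The sesquilinear spectral integral `∫ φ(x) d⟨v, E_x u⟩`, where the complex measure
`d⟨v, E_x u⟩ = (1/4) ∑_{k<4} i^k d⟨u + i^k v, E_x (u + i^k v)⟩` is written out by polarization. -/
def sesqIntegral (E : ResolutionOfIdentity V) (φ : ℝ → ℂ) (v u : V) : ℂ :=
  (1 / 4) * ∑ k ∈ Finset.range 4,
    Complex.I ^ k * ∫ x, φ x ∂(E.distribution (u + Complex.I ^ k • v))

/-- `T = ∫ φ(x) dE_x` as a possibly unbounded operator: its domain consists of all `u` with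
`∫ |φ(x)|² d⟨u, E_x u⟩ < ∞`, and `⟨v, T u⟩ = ∫ φ(x) d⟨v, E_x u⟩` for `u`, `v` in this
(always dense) domain. -/
def IsSpectralIntegral (E : ResolutionOfIdentity V) (φ : ℝ → ℂ) (T : V →ₗ.[ℂ] V) : Prop :=
  (∀ u : V, u ∈ T.domain ↔ MemLp φ 2 (E.distribution u)) ∧
  ∀ v u : T.domain, ⟪(v : V), T u⟫_ℂ = E.sesqIntegral φ v u

/-- `E` is a spectral resolution of the operator `A`, that is, `A = ∫ x dE_x`. -/
def IsSpectralResolution (E : ResolutionOfIdentity V) (A : V →ₗ.[ℂ] V) : Prop :=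
  E.IsSpectralIntegral (fun x => (x : ℂ)) A

/-- For the operator `A` with spectral resolution `E`, the everywhere defined bounded operator `U`
is `e^{itA} = ∫ e^{itx} dE_x`. -/
def IsExp (E : ResolutionOfIdentity V) (t : ℝ) (U : V →L[ℂ] V) : Prop :=
  E.IsSpectralIntegral (fun x => Complex.exp (Complex.I * t * x))
    ((U : V →ₗ[ℂ] V).toPMap ⊤)

end ResolutionOfIdentity

/-! ### Position, momentum and the vacuum vector, for `ħ = 1` -/

/-- The Hilbert space `L²(ℝ, ℂ)`, with inner product `∫ conj (f x) * g x`. -/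
abbrev L2R : Type := Lp ℂ 2 (volume : Measure ℝ)

/-- The position operator `(X f)(x) = x f(x)`, with domain `{f ∈ L² | x f(x) ∈ L²}`. -/
def position : L2R →ₗ.[ℂ] L2R where
  domain :=
    { carrier := {f | MemLp (fun x : ℝ => (x : ℂ) * f x) 2 volume}
      zero_mem' := by
        refine (memLp_congr_ae ?_).2 (MemLp.zero : MemLp (0 : ℝ → ℂ) 2 volume)
        filter_upwards [Lp.coeFn_zero ℂ 2 (volume : Measure ℝ)] with x hx
        simp
      add_mem' := by
        intro f g hf hg
        refine (memLp_congr_ae ?_).2 (MemLp.add hf hg)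
        filter_upwards [Lp.coeFn_add f g] with x hx
        simp only [hx, Pi.add_apply, mul_add]
      smul_mem' := by
        intro c f hf
        refine (memLp_congr_ae ?_).2 (MemLp.const_smul hf c)
        filter_upwards [Lp.coeFn_smul c f] with x hx
        simp only [hx, Pi.smul_apply, smul_eq_mul]
        ring }
  toFun :=
    { toFun := fun f => MemLp.toLp _ f.2
      map_add' := by
        intro f g
        rw [← MemLp.toLp_add]
        refine MemLp.toLp_congr _ _ ?_
        filter_upwards [Lp.coeFn_add (f : L2R) (g : L2R)] with x hx
        simp only [Submodule.coe_add, hx, Pi.add_apply, mul_add]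
      map_smul' := by
        intro c f
        rw [RingHom.id_apply, ← MemLp.toLp_const_smul]
        refine MemLp.toLp_congr _ _ ?_
        filter_upwards [Lp.coeFn_smul c (f : L2R)] with x hx
        simp only [Submodule.coe_smul, hx, Pi.smul_apply, smul_eq_mul]
        ring }

/-- `g` is an absolutely continuous representative of `f ∈ L²(ℝ, ℂ)` with `g' ∈ L²`. -/
structure IsACRep (f : L2R) (g : ℝ → ℂ) : Prop where
  ae_eq : f =ᵐ[volume] g
  ac : ∀ a b : ℝ, AbsolutelyContinuousOnInterval g a b
  memLp_deriv : MemLp (deriv g) 2 volume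

namespace IsACRep

theorem continuous {f : L2R} {g : ℝ → ℂ} (h : IsACRep f g) : Continuous g := by
  refine continuous_iff_continuousAt.2 fun x => ?_
  refine (h.ac (x - 1) (x + 1)).continuousOn.continuousAt ?_
  rw [Set.uIcc_of_le (by linarith)]
  exact Icc_mem_nhds (by linarith) (by linarith)

theorem unique {f : L2R} {g g' : ℝ → ℂ} (h : IsACRep f g) (h' : IsACRep f g') : g = g' :=
  (Continuous.ae_eq_iff_eq volume h.continuous h'.continuous).1 (h.ae_eq.symm.trans h'.ae_eq)

theorem ae_differentiableAt {f : L2R} {g : ℝ → ℂ} (h : IsACRep f g) :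
    ∀ᵐ x, DifferentiableAt ℝ g x := by
  have : ∀ᵐ x, ∀ n : ℕ, x ∈ Set.uIcc (-(n : ℝ)) n → DifferentiableAt ℝ g x :=
    ae_all_iff.2 fun n => (h.ac _ _).boundedVariationOn.ae_differentiableAt_of_mem_uIcc
  filter_upwards [this] with x hx
  obtain ⟨n, hn⟩ := exists_nat_ge |x|
  refine hx n ?_
  rw [Set.uIcc_of_le (by linarith [abs_nonneg x])]
  exact ⟨(abs_le.1 hn).1, (abs_le.1 hn).2⟩

theorem deriv_add_ae {f f' : L2R} {g g' : ℝ → ℂ} (h : IsACRep f g) (h' : IsACRep f' g') :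
    deriv (g + g') =ᵐ[volume] deriv g + deriv g' := by
  filter_upwards [h.ae_differentiableAt, h'.ae_differentiableAt] with x hx hx'
  simp [deriv_add hx hx']

theorem zero : IsACRep 0 0 where
  ae_eq := Lp.coeFn_zero ℂ 2 (volume : Measure ℝ)
  ac a b := (LipschitzWith.const (0 : ℂ)).lipschitzOnWith.absolutelyContinuousOnInterval
  memLp_deriv := by simp

theorem add {f f' : L2R} {g g' : ℝ → ℂ} (h : IsACRep f g) (h' : IsACRep f' g') :
    IsACRep (f + f') (g + g') where
  ae_eq := (Lp.coeFn_add f f').trans (h.ae_eq.add h'.ae_eq)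
  ac a b := (h.ac a b).add (h'.ac a b)
  memLp_deriv := (memLp_congr_ae (h.deriv_add_ae h')).2 (h.memLp_deriv.add h'.memLp_deriv)

theorem deriv_smul (c : ℂ) (g : ℝ → ℂ) : deriv (c • g) = c • deriv g := by
  funext x
  exact deriv_const_smul_field c g

theorem smul {f : L2R} {g : ℝ → ℂ} (c : ℂ) (h : IsACRep f g) : IsACRep (c • f) (c • g) where
  ae_eq := (Lp.coeFn_smul c f).trans (h.ae_eq.const_smul c)
  ac a b := (h.ac a b).const_smul c
  memLp_deriv := by
    rw [deriv_smul]
    exact h.memLp_deriv.const_smul c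

end IsACRep

/-- The momentum operator `(P f)(x) = -i f'(x)`, with domain
`{f ∈ L² | f is absolutely continuous, f' ∈ L²}`. -/
def momentum : L2R →ₗ.[ℂ] L2R where
  domain :=
    { carrier := {f | ∃ g : ℝ → ℂ, IsACRep f g}
      zero_mem' := ⟨0, IsACRep.zero⟩
      add_mem' := by
        rintro f f' ⟨g, h⟩ ⟨g', h'⟩
        exact ⟨g + g', h.add h'⟩
      smul_mem' := by
        rintro c f ⟨g, h⟩
        exact ⟨c • g, h.smul c⟩ }
  toFun :=
    { toFun := fun f => (-Complex.I) • f.2.choose_spec.memLp_deriv.toLp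
      map_add' := by
        intro f f'
        rw [← smul_add, ← MemLp.toLp_add]
        congr 1
        refine MemLp.toLp_congr _ _ ?_
        rw [(f + f').2.choose_spec.unique (f.2.choose_spec.add f'.2.choose_spec)]
        exact f.2.choose_spec.deriv_add_ae f'.2.choose_spec
      map_smul' := by
        intro c f
        rw [RingHom.id_apply, smul_comm c]
        refine congrArg (fun h : L2R => (-Complex.I) • h)
          ((MemLp.toLp_congr _ (f.2.choose_spec.memLp_deriv.const_smul c) ?_).trans
            (MemLp.toLp_const_smul c _))
        rw [(c • f).2.choose_spec.unique (f.2.choose_spec.smul c), IsACRep.deriv_smul] }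

theorem momentum_apply (f : momentum.domain) {g : ℝ → ℂ} (h : IsACRep (f : L2R) g) :
    momentum f = (-Complex.I) • h.memLp_deriv.toLp := by
  change (-Complex.I) • f.2.choose_spec.memLp_deriv.toLp = _
  congr 1
  refine MemLp.toLp_congr _ _ ?_
  rw [f.2.choose_spec.unique h]

/-- The observable `X + P`. The sum is defined on `dom X ∩ dom P`, and the observable is its
operator closure. -/
def positionAddMomentum : L2R →ₗ.[ℂ] L2R := (position + momentum).closure

/-- The Gaussian function `π^{-1/4} e^{-x²/2}`. -/
def vacuumFun (x : ℝ) : ℂ := ((Real.pi ^ (-(1 / 4) : ℝ) * Real.exp (-x ^ 2 / 2) : ℝ) : ℂ)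

theorem memLp_vacuumFun : MemLp vacuumFun 2 volume := by
  have hc : Continuous vacuumFun := by
    unfold vacuumFun
    fun_prop
  rw [memLp_two_iff_integrable_sq_norm hc.aestronglyMeasurable]
  have h := (integrable_exp_neg_mul_sq (b := 1) one_pos).const_mul
    ((Real.pi ^ (-(1 / 4) : ℝ)) ^ 2)
  refine h.congr (ae_of_all _ fun x => ?_)
  simp only [vacuumFun, Complex.norm_real, Real.norm_eq_abs, sq_abs, mul_pow]
  rw [← Real.exp_nat_mul]
  congr 2
  push_cast
  ring

/-- The vacuum vector `Φ(x) = π^{-1/4} e^{-x²/2}` in `L²(ℝ, ℂ)`. -/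
def vacuum : L2R := memLp_vacuumFun.toLp

end

noncomputable section

/-! ### Projections, their distributions and polarized integrals -/

namespace ResolutionOfIdentity

variable {V : Type*} [NormedAddCommGroup V] [InnerProductSpace ℂ V] [CompleteSpace V]

/-! Write `c(x) = e^{ix²/2}`. The product rule gives `P (c f) = c (x f - i f')`, so multiplication
by `c` turns `X + P` into `P`, and the Fourier transform, with kernel `e^{-2πixξ}`, turns `P` into
multiplication by `2πξ`. Hence the unitary `diagU : f ↦ 𝓕 (c f)` makes `X + P` a restriction of a
multiplication operator `M` (`position_add_momentum_le`). `M` is self-adjoint because `M ± i` are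
onto. The restriction has closure `M`: the range of `X + P + i` is dense, and `‖(M + i) u‖² = ‖M u‖²
+ ‖u‖²` converts convergence of `(M + i) xₙ` into convergence in the graph
(`LinearPMap.closure_eq_of_dense_range`).

For a multiplication operator by a real function `m`, the projections `1_{m ≤ x}` form a spectral
resolution, and the exponentials are multiplications by functions of modulus one. Uniqueness does
not rest on a general spectral theorem. If `E` resolves `M`, then on the range of `E_b - E_a` the
operator `M` differs from its midpoint `(a + b) / 2` by at most `(b - a) / 2` in norm. Iterating
this bound forces vectors there to be supported in `{a ≤ m ≤ b}`, and right continuity then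
identifies `E` with the indicator projections.

Finally `c Φ` is a complex Gaussian, so `diagU Φ` is one too. Its squared modulus is the density of
`N(0, (2π)⁻²)`, and pushing this forward by `ξ ↦ 2πξ` gives `N(0, 1)`, whose characteristic function
is `e^{-t²/2}`. -/

theorem ext_proj {E E' : ResolutionOfIdentity V} (h : ∀ x, E.proj x = E'.proj x) : E = E' := by
  have : E.proj = E'.proj := funext h
  cases E; cases E'; congr

variable (E : ResolutionOfIdentity V)

theorem inner_proj_left (x : ℝ) (u v : V) : ⟪E.proj x u, v⟫_ℂ = ⟪u, E.proj x v⟫_ℂ := by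
  rw [← ContinuousLinearMap.adjoint_inner_left,
    ContinuousLinearMap.isSelfAdjoint_iff'.1 (E.isStarProjection x).isSelfAdjoint]

theorem proj_proj_of_le {x y : ℝ} (h : x ≤ y) (u : V) :
    E.proj x (E.proj y u) = E.proj x u := by
  simpa using congrArg (fun T : V →L[ℂ] V => T u) (E.proj_mul_proj x y h)

theorem proj_proj_of_ge {x y : ℝ} (h : y ≤ x) (u : V) :
    E.proj x (E.proj y u) = E.proj y u := by
  refine ext_inner_left ℂ fun v => ?_
  rw [← inner_proj_left, ← inner_proj_left, ← inner_proj_left, proj_proj_of_le E h]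

theorem proj_proj (x y : ℝ) (u : V) : E.proj x (E.proj y u) = E.proj (min x y) u := by
  rcases le_total x y with h | h
  · rw [proj_proj_of_le E h, min_eq_left h]
  · rw [proj_proj_of_ge E h, min_eq_right h]

theorem norm_sub_proj_sq (x : ℝ) (u : V) :
    ‖u - E.proj x u‖ ^ 2 = ‖u‖ ^ 2 - ‖E.proj x u‖ ^ 2 := by
  have h := E.re_inner_proj x u
  have h2 := norm_sub_sq (𝕜 := ℂ) u (E.proj x u)
  simp only [RCLike.re_to_complex] at h2
  rw [h2, h]
  ring

theorem cdf_apply (u : V) (x : ℝ) : E.cdf u x = ‖E.proj x u‖ ^ 2 := E.re_inner_proj x u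

theorem tendsto_cdf_atBot (u : V) : Tendsto (E.cdf u) atBot (𝓝 0) := by
  have := ((E.tendsto_atBot u).norm.pow 2)
  simpa [← cdf_apply] using this

theorem tendsto_cdf_atTop (u : V) : Tendsto (E.cdf u) atTop (𝓝 (‖u‖ ^ 2)) := by
  have := ((E.tendsto_atTop u).norm.pow 2)
  simpa [← cdf_apply] using this

instance isFiniteMeasure_distribution (u : V) : IsFiniteMeasure (E.distribution u) :=
  (E.cdf u).isFiniteMeasure (E.tendsto_cdf_atBot u) (E.tendsto_cdf_atTop u)

theorem distribution_Iic (u : V) (x : ℝ) :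
    E.distribution u (Set.Iic x) = ENNReal.ofReal (‖E.proj x u‖ ^ 2) := by
  rw [distribution, StieltjesFunction.measure_Iic _ (E.tendsto_cdf_atBot u), cdf_apply, sub_zero]

theorem distribution_real_univ (u : V) : (E.distribution u).real Set.univ = ‖u‖ ^ 2 := by
  rw [Measure.real, distribution,
    StieltjesFunction.measure_univ _ (E.tendsto_cdf_atBot u) (E.tendsto_cdf_atTop u), sub_zero,
    ENNReal.toReal_ofReal (by positivity)]

theorem distribution_proj (y : ℝ) (u : V) :
    E.distribution (E.proj y u) = (E.distribution u).restrict (Set.Iic y) := by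
  refine Measure.ext_of_Iic _ _ fun x => ?_
  rw [Measure.restrict_apply measurableSet_Iic, Set.Iic_inter_Iic, distribution_Iic,
    distribution_Iic, proj_proj]

/-- Pythagoras: `‖E_x u - E_y E_x u‖² = ‖E_x u‖² - ‖E_y u‖²` for `y ≤ x`, which is the mass of `(y,
x]`. -/
theorem distribution_sub_proj (y : ℝ) (u : V) :
    E.distribution (u - E.proj y u) = (E.distribution u).restrict (Set.Ioi y) := by
  refine Measure.ext_of_Iic _ _ fun x => ?_
  rw [Measure.restrict_apply measurableSet_Iic, Set.inter_comm, Set.Ioi_inter_Iic,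
    distribution_Iic, distribution, StieltjesFunction.measure_Ioc, cdf_apply, cdf_apply, map_sub,
    proj_proj]
  rcases le_total x y with h | h
  · rw [min_eq_left h, sub_self, norm_zero, ENNReal.ofReal_of_nonpos (by simp),
      ENNReal.ofReal_of_nonpos]
    rw [sub_nonpos, ← cdf_apply, ← cdf_apply]
    exact (E.cdf u).mono h
  · have h1 := E.norm_sub_proj_sq y (E.proj x u)
    rw [proj_proj_of_le E h] at h1
    rw [min_eq_right h, h1]

theorem distribution_eq_add (y : ℝ) (u : V) :
    E.distribution u = E.distribution (E.proj y u) + E.distribution (u - E.proj y u) := by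
  rw [distribution_proj, distribution_sub_proj, ← Set.compl_Iic,
    Measure.restrict_add_restrict_compl measurableSet_Iic]

theorem distribution_smul (c : ℂ) (u : V) :
    E.distribution (c • u) = ENNReal.ofReal (‖c‖ ^ 2) • E.distribution u := by
  have : IsFiniteMeasure (ENNReal.ofReal (‖c‖ ^ 2) • E.distribution u) :=
    Measure.smul_finite _ ENNReal.ofReal_ne_top
  refine Measure.ext_of_Iic _ _ fun x => ?_
  rw [Measure.smul_apply, distribution_Iic, distribution_Iic, map_smul, norm_smul, mul_pow,
    ENNReal.ofReal_mul (by positivity), smul_eq_mul]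

theorem distribution_I_pow_smul (k : ℕ) (u : V) :
    E.distribution (Complex.I ^ k • u) = E.distribution u := by
  simp [distribution_smul]

/-- The weights `‖1 + i^k‖²` are `4, 2, 0, 2`, and `4 + 2i + 0 - 2i = 4` cancels the factor `1/4`.
-/
theorem sesqIntegral_self (φ : ℝ → ℂ) (u : V) :
    E.sesqIntegral φ u u = ∫ x, φ x ∂E.distribution u := by
  have key (k : ℕ) : ∫ x, φ x ∂E.distribution (u + Complex.I ^ k • u)
      = ((‖1 + Complex.I ^ k‖ ^ 2 : ℝ) : ℂ) * ∫ x, φ x ∂E.distribution u := by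
    have : u + Complex.I ^ k • u = (1 + Complex.I ^ k) • u := by rw [add_smul, one_smul]
    rw [this, distribution_smul, integral_smul_measure, ENNReal.toReal_ofReal (by positivity)]
    simp
  simp only [sesqIntegral, key, Complex.sq_norm, Finset.sum_range_succ, Finset.sum_range_zero,
    Complex.normSq_apply]
  simp [pow_succ]
  ring

/-- Splitting each polarized integral at `y`, both sides have the same part on `(-∞, y]`. The parts
on `(y, ∞)` do not depend on `k` and vanish in the sum because `∑ i^k = 0`. This is how `E_y` is
seen to commute with the operator, although no product rule for spectral integrals is available yet.
-/
theorem sesqIntegral_proj (φ : ℝ → ℂ) (y : ℝ) (u v : V)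
    (h : ∀ k : ℕ, Integrable φ (E.distribution (u + Complex.I ^ k • v)))
    (hu : Integrable φ (E.distribution u)) (hv : Integrable φ (E.distribution v)) :
    E.sesqIntegral φ v (E.proj y u) = E.sesqIntegral φ (E.proj y v) u := by
  have h1 (k : ℕ) : ∫ x, φ x ∂E.distribution (E.proj y u + Complex.I ^ k • v)
      = (∫ x in Set.Iic y, φ x ∂E.distribution (u + Complex.I ^ k • v))
        + ∫ x in Set.Ioi y, φ x ∂E.distribution v := by
    have e1 : E.proj y (E.proj y u + Complex.I ^ k • v)
        = E.proj y (u + Complex.I ^ k • v) := by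
      simp [proj_proj]
    have e2 : E.proj y u + Complex.I ^ k • v - E.proj y (u + Complex.I ^ k • v)
        = Complex.I ^ k • (v - E.proj y v) := by
      rw [map_add, map_smul, smul_sub]; abel
    rw [distribution_eq_add E y, e1, e2, distribution_I_pow_smul, distribution_proj,
      distribution_sub_proj, integral_add_measure (h k).restrict hv.restrict]
  have h2 (k : ℕ) : ∫ x, φ x ∂E.distribution (u + Complex.I ^ k • E.proj y v)
      = (∫ x in Set.Iic y, φ x ∂E.distribution (u + Complex.I ^ k • v))
        + ∫ x in Set.Ioi y, φ x ∂E.distribution u := by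
    have e1 : E.proj y (u + Complex.I ^ k • E.proj y v)
        = E.proj y (u + Complex.I ^ k • v) := by
      simp [proj_proj]
    have e2 : u + Complex.I ^ k • E.proj y v - E.proj y (u + Complex.I ^ k • v)
        = u - E.proj y u := by
      rw [map_add, map_smul]; abel
    rw [distribution_eq_add E y, e1, e2, distribution_proj,
      distribution_sub_proj, integral_add_measure (h k).restrict hu.restrict]
  simp only [sesqIntegral, h1, h2, Finset.sum_range_succ, Finset.sum_range_zero]
  simp [pow_succ]
  ring

/-! ### Operators with a spectral resolution, on the ranges of `E_b - E_a` -/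

section Resolution

variable {E} {A : V →ₗ.[ℂ] V}

theorem IsSpectralResolution.proj_mem_domain (hA : E.IsSpectralResolution A) (y : ℝ) {u : V}
    (hu : u ∈ A.domain) : E.proj y u ∈ A.domain := by
  rw [hA.1, distribution_proj]
  exact ((hA.1 u).1 hu).restrict _

theorem IsSpectralResolution.integrable (hA : E.IsSpectralResolution A) {u : V}
    (hu : u ∈ A.domain) : Integrable (fun x : ℝ => (x : ℂ)) (E.distribution u) :=
  ((hA.1 u).1 hu).integrable one_le_two

theorem IsSpectralResolution.apply_proj (hA : E.IsSpectralResolution A)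
    (hd : Dense (A.domain : Set V)) (y : ℝ) (u : A.domain) :
    A ⟨E.proj y u, hA.proj_mem_domain y u.2⟩ = E.proj y (A u) := by
  refine hd.eq_of_inner_right ℂ fun v hv => ?_
  rw [← inner_proj_left, hA.2 ⟨v, hv⟩, hA.2 ⟨E.proj y v, hA.proj_mem_domain y hv⟩ u]
  exact E.sesqIntegral_proj _ _ _ _
    (fun k => hA.integrable (A.domain.add_mem u.2 (A.domain.smul_mem _ hv)))
    (hA.integrable u.2) (hA.integrable hv)

/-- The range of the spectral projection `E_b - E_a`. -/
def spectralSubspace (E : ResolutionOfIdentity V) (a b : ℝ) : Submodule ℂ V where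
  carrier := {u | E.proj b u = u ∧ E.proj a u = 0}
  zero_mem' := by simp
  add_mem' := by
    rintro u v ⟨h1, h2⟩ ⟨h3, h4⟩
    simp [h1, h2, h3, h4]
  smul_mem' := by
    rintro c u ⟨h1, h2⟩
    simp [h1, h2]

theorem proj_sub_proj_mem_spectralSubspace (E : ResolutionOfIdentity V) {a b : ℝ} (h : a ≤ b)
    (u : V) : E.proj b u - E.proj a u ∈ E.spectralSubspace a b := by
  constructor <;> simp [proj_proj, h]

theorem ae_mem_Ioc {a b : ℝ} {u : V} (hu : u ∈ E.spectralSubspace a b) :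
    ∀ᵐ x ∂E.distribution u, x ∈ Set.Ioc a b := by
  have h1 : ∀ᵐ x ∂E.distribution u, x ∈ Set.Iic b := by
    rw [← hu.1, distribution_proj]
    exact ae_restrict_mem measurableSet_Iic
  have h2 : ∀ᵐ x ∂E.distribution u, x ∈ Set.Ioi a := by
    have : u = u - E.proj a u := by rw [hu.2, sub_zero]
    rw [this, distribution_sub_proj]
    exact ae_restrict_mem measurableSet_Ioi
  filter_upwards [h1, h2] with x hx hx' using ⟨hx', hx⟩

theorem IsSpectralResolution.spectralSubspace_le_domain (hA : E.IsSpectralResolution A)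
    (a b : ℝ) : E.spectralSubspace a b ≤ A.domain := by
  intro u hu
  rw [hA.1]
  refine MemLp.of_bound (by fun_prop) (max |a| |b|) ?_
  filter_upwards [ae_mem_Ioc hu] with x hx
  rw [Complex.norm_real, Real.norm_eq_abs]
  exact abs_le_max_abs_abs hx.1.le hx.2

theorem IsSpectralResolution.apply_mem_spectralSubspace (hA : E.IsSpectralResolution A)
    (hd : Dense (A.domain : Set V)) {a b : ℝ} (u : A.domain)
    (hu : (u : V) ∈ E.spectralSubspace a b) : A u ∈ E.spectralSubspace a b := by
  constructor
  · rw [← hA.apply_proj hd]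
    congr 1
    exact Subtype.ext hu.1
  · rw [← hA.apply_proj hd]
    have : (⟨E.proj a u, hA.proj_mem_domain a u.2⟩ : A.domain) = 0 := Subtype.ext hu.2
    rw [this, LinearPMap.map_zero]

/-- The distribution of `u` lives on `(a, b]`, where `x` is within `(b - a) / 2` of the midpoint,
and its total mass is `‖u‖²`. -/
theorem IsSpectralResolution.norm_inner_sub_le (hA : E.IsSpectralResolution A) {a b : ℝ}
    (u : A.domain) (hu : (u : V) ∈ E.spectralSubspace a b) :
    ‖⟪(u : V), A u - (((a + b) / 2 : ℝ) : ℂ) • (u : V)⟫_ℂ‖ ≤ (b - a) / 2 * ‖(u : V)‖ ^ 2 := by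
  have h1 : ⟪(u : V), A u - (((a + b) / 2 : ℝ) : ℂ) • (u : V)⟫_ℂ
      = ∫ x, ((x : ℂ) - (((a + b) / 2 : ℝ) : ℂ)) ∂E.distribution u := by
    rw [integral_sub (hA.integrable u.2) (integrable_const _), inner_sub_right, inner_smul_right,
      hA.2, sesqIntegral_self, inner_self_eq_norm_sq_to_K, integral_const, distribution_real_univ,
      Complex.real_smul, mul_comm]
    simp
  rw [h1, ← E.distribution_real_univ]
  refine norm_integral_le_of_norm_le_const ?_
  filter_upwards [ae_mem_Ioc hu] with x hx
  rw [← Complex.ofReal_sub, Complex.norm_real, Real.norm_eq_abs, abs_le]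
  constructor <;> linarith [hx.1, hx.2]

/-- A symmetric operator is bounded in norm by the bound of its quadratic form. The definition of a
spectral integral supplies only matrix elements, so the norm is recovered by polarization: `Q(u + v)
- Q(u - v) = 4 Re ⟨v, w⟩`, with `v` a multiple of `w = A u - c u`. -/
theorem IsSpectralResolution.norm_sub_le (hA : E.IsSpectralResolution A)
    (hd : Dense (A.domain : Set V)) (hs : A.IsFormalAdjoint A) {a b : ℝ}
    (u : A.domain) (hu : (u : V) ∈ E.spectralSubspace a b) :
    ‖A u - (((a + b) / 2 : ℝ) : ℂ) • (u : V)‖ ≤ (b - a) / 2 * ‖(u : V)‖ := by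
  set c : ℂ := (((a + b) / 2 : ℝ) : ℂ) with hc
  set w : V := A u - c • (u : V) with hw
  have hwm : w ∈ E.spectralSubspace a b :=
    Submodule.sub_mem _ (hA.apply_mem_spectralSubspace hd u hu) (Submodule.smul_mem _ _ hu)
  rcases eq_or_ne w 0 with h0 | h0
  · have := (norm_nonneg _).trans (hA.norm_inner_sub_le u hu)
    rcases eq_or_ne (u : V) 0 with hu0 | hu0
    · simp [h0, hu0]
    · have hp : 0 < ‖(u : V)‖ ^ 2 := by positivity
      have : 0 ≤ (b - a) / 2 := nonneg_of_mul_nonneg_left this hp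
      rw [h0, norm_zero]
      positivity
  have hu0 : (u : V) ≠ 0 := by
    intro hu0
    have : u = 0 := Subtype.ext hu0
    exact h0 (by rw [hw, hu0, this]; simp)
  have hwp : 0 < ‖w‖ := norm_pos_iff.2 h0
  have hup : 0 < ‖(u : V)‖ := norm_pos_iff.2 hu0
  -- This scaling gives `‖v‖ = ‖u‖`, which makes the parallelogram law yield exactly `4 ‖u‖²`.
  set s : ℂ := ((‖(u : V)‖ / ‖w‖ : ℝ) : ℂ) with hsdef
  let v : A.domain := ⟨s • w, A.domain.smul_mem _ (hA.spectralSubspace_le_domain a b hwm)⟩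
  have hv : (v : V) ∈ E.spectralSubspace a b := Submodule.smul_mem _ _ hwm
  have hvn : ‖(v : V)‖ = ‖(u : V)‖ := by
    change ‖s • w‖ = _
    rw [norm_smul, hsdef, Complex.norm_real, Real.norm_of_nonneg (by positivity)]
    field_simp
  have hp := (Complex.re_le_norm _).trans
    (hA.norm_inner_sub_le (u + v) (Submodule.add_mem _ hu hv))
  have hm := (neg_le_abs _).trans ((Complex.abs_re_le_norm _).trans
    (hA.norm_inner_sub_le (u - v) (Submodule.sub_mem _ hu hv)))
  have hpar := parallelogram_law_with_norm ℂ (u : V) (v : V)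
  have hAp : A (u + v) - c • ((u + v : A.domain) : V) = w + (A v - c • (v : V)) := by
    rw [LinearPMap.map_add, Submodule.coe_add, smul_add, hw]; abel
  have hAm : A (u - v) - c • ((u - v : A.domain) : V) = w - (A v - c • (v : V)) := by
    rw [LinearPMap.map_sub, AddSubgroupClass.coe_sub, smul_sub, hw]; abel
  have hsym : ⟪(u : V), A v - c • (v : V)⟫_ℂ = ⟪w, (v : V)⟫_ℂ := by
    rw [hw, inner_sub_left, inner_sub_right, hs u v, inner_smul_left, inner_smul_right, hc,
      Complex.conj_ofReal]
  have hsw : ⟪(v : V), w⟫_ℂ = ((‖(u : V)‖ * ‖w‖ : ℝ) : ℂ) := by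
    change ⟪s • w, w⟫_ℂ = _
    rw [inner_smul_left, inner_self_eq_norm_sq_to_K, hsdef, Complex.conj_ofReal]
    have : (‖w‖ : ℂ) ≠ 0 := Complex.ofReal_ne_zero.2 hwp.ne'
    change _ * (‖w‖ : ℂ) ^ 2 = _
    push_cast
    field_simp
  have hws : ⟪w, (v : V)⟫_ℂ = ((‖(u : V)‖ * ‖w‖ : ℝ) : ℂ) := by
    rw [← inner_conj_symm, hsw, Complex.conj_ofReal]
  rw [← hc, hAp] at hp
  rw [← hc, hAm] at hm
  simp only [Submodule.coe_add, AddSubgroupClass.coe_sub, inner_add_left, inner_add_right,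
    inner_sub_left, inner_sub_right (𝕜 := ℂ) _ w, hsym, hsw, hws, Complex.add_re, Complex.sub_re,
    Complex.ofReal_re] at hp hm
  have h4 : 4 * (‖(u : V)‖ * ‖w‖) ≤ (b - a) / 2 * (4 * ‖(u : V)‖ ^ 2) := by
    have e : ‖(u : V) + v‖ ^ 2 + ‖(u : V) - v‖ ^ 2 = 4 * ‖(u : V)‖ ^ 2 := by
      rw [hvn] at hpar
      linarith
    rw [← e, mul_add]
    linarith
  have : ‖(u : V)‖ * ‖w‖ ≤ ‖(u : V)‖ * ((b - a) / 2 * ‖(u : V)‖) := by linarith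
  exact le_of_mul_le_mul_left this hup

end Resolution

end ResolutionOfIdentity

/-! ### A range criterion for self-adjointness -/

section SelfAdjoint

variable {V : Type*} [NormedAddCommGroup V] [InnerProductSpace ℂ V]

theorem LinearPMap.IsFormalAdjoint.inner_self_im {A : V →ₗ.[ℂ] V} (hs : A.IsFormalAdjoint A)
    (x : A.domain) : (⟪(x : V), A x⟫_ℂ).im = 0 := by
  rw [← Complex.conj_eq_iff_im, inner_conj_symm]
  exact hs x x

variable [CompleteSpace V]

/-- If `w = (A + i) x` is orthogonal to the domain, then `0 = ⟨x, A x⟩ + i ‖x‖²` with the first term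
real, so `x = 0`. -/
theorem LinearPMap.IsFormalAdjoint.dense_domain {A : V →ₗ.[ℂ] V} (hs : A.IsFormalAdjoint A)
    (hp : ∀ w : V, ∃ x : A.domain, A x + Complex.I • (x : V) = w) :
    Dense (A.domain : Set V) := by
  rw [Submodule.dense_iff_topologicalClosure_eq_top, Submodule.topologicalClosure_eq_top_iff,
    Submodule.eq_bot_iff]
  intro w hw
  obtain ⟨x, rfl⟩ := hp w
  have h := (Submodule.mem_orthogonal _ _).1 hw x x.2
  rw [inner_add_right, inner_smul_right, inner_self_eq_norm_sq_to_K] at h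
  have h1 := congrArg Complex.im h
  rw [Complex.add_im, hs.inner_self_im] at h1
  have h2 : ‖(x : V)‖ = 0 := by
    have : (Complex.I * (‖(x : V)‖ : ℂ) ^ 2).im = 0 := by simpa using h1
    rw [← Complex.ofReal_pow, Complex.I_mul_im, Complex.ofReal_re] at this
    simpa using this
  have h3 : x = 0 := Subtype.ext (norm_eq_zero.1 h2)
  rw [h3]
  simp

/-- For `y` in the domain of the adjoint, solve `(A + i) x = (A* + i) y`. Then `y - x` is orthogonal
to the range of `A - i`, which is everything, so `y = x` lies in the domain of `A`. -/
theorem LinearPMap.IsFormalAdjoint.isSelfAdjoint {A : V →ₗ.[ℂ] V} (hs : A.IsFormalAdjoint A)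
    (hp : ∀ w : V, ∃ x : A.domain, A x + Complex.I • (x : V) = w)
    (hm : ∀ w : V, ∃ x : A.domain, A x - Complex.I • (x : V) = w) : IsSelfAdjoint A := by
  have hd := hs.dense_domain hp
  have hle : A ≤ A.adjoint := hs.le_adjoint hd
  rw [LinearPMap.isSelfAdjoint_def]
  refine (LinearPMap.eq_of_le_of_domain_eq hle (le_antisymm hle.1 fun y hy => ?_)).symm
  obtain ⟨x, hx⟩ := hp (A.adjoint ⟨y, hy⟩ + Complex.I • y)
  obtain ⟨z, hz⟩ := hm (y - x)
  have h1 : ⟪A.adjoint ⟨y, hy⟩, (z : V)⟫_ℂ = ⟪y, A z⟫_ℂ := A.adjoint_isFormalAdjoint hd ⟨y, hy⟩ z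
  have h2 : ⟪A x + Complex.I • (x : V), (z : V)⟫_ℂ
      = ⟪A.adjoint ⟨y, hy⟩ + Complex.I • y, (z : V)⟫_ℂ := by rw [hx]
  have h3 : ⟪y - x, A z - Complex.I • (z : V)⟫_ℂ = 0 := by
    simp only [inner_add_left, inner_smul_left, hs x z, h1, Complex.conj_I] at h2
    simp only [inner_sub_left, inner_sub_right, inner_smul_right]
    linear_combination -h2
  rw [hz, inner_self_eq_zero, sub_eq_zero] at h3
  rw [h3]
  exact x.2

end SelfAdjoint

/-! ### Multiplication operators on `L²` -/

section Multiplication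

variable {α : Type*} [MeasurableSpace α] {μ : Measure α}

theorem L2_inner_eq_integral (f g : Lp ℂ 2 μ) :
    ⟪f, g⟫_ℂ = ∫ x, (starRingEnd ℂ) (f x) * g x ∂μ := by
  rw [L2.inner_def]
  simp only [RCLike.inner_apply, mul_comm]

theorem L2_ofReal_norm_sq (f : Lp ℂ 2 μ) :
    ENNReal.ofReal (‖f‖ ^ 2) = ∫⁻ x, ‖f x‖ₑ ^ 2 ∂μ := by
  rw [ENNReal.ofReal_pow (norm_nonneg _), ofReal_norm, Lp.enorm_def,
    eLpNorm_eq_lintegral_rpow_enorm_toReal two_ne_zero ENNReal.ofNat_ne_top]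
  rw [← ENNReal.rpow_natCast, ← ENNReal.rpow_mul]
  norm_num

theorem L2_norm_sq (f : Lp ℂ 2 μ) : ‖f‖ ^ 2 = ∫ x, ‖f x‖ ^ 2 ∂μ := by
  rw [integral_eq_lintegral_of_nonneg_ae (ae_of_all _ fun x => by positivity)
    (by fun_prop), ← ENNReal.toReal_ofReal (sq_nonneg ‖f‖),
    L2_ofReal_norm_sq]
  simp [ENNReal.ofReal_pow]

/-- Multiplication by an essentially bounded function, as a bounded operator on `L²`. -/
def mulL {φ : α → ℂ} (hφ : MemLp φ ⊤ μ) : Lp ℂ 2 μ →L[ℂ] Lp ℂ 2 μ :=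
  (ContinuousLinearMap.mul ℂ ℂ).holderL μ ⊤ 2 2 hφ.toLp

theorem coeFn_mulL {φ : α → ℂ} (hφ : MemLp φ ⊤ μ) (f : Lp ℂ 2 μ) :
    mulL hφ f =ᵐ[μ] fun x => φ x * f x := by
  have h := (ContinuousLinearMap.mul ℂ ℂ).coeFn_holder (r := 2) hφ.toLp f
  filter_upwards [h, hφ.coeFn_toLp] with x hx hx'
  rw [← hx']
  exact hx

variable {V : Type*} [NormedAddCommGroup V] [InnerProductSpace ℂ V]

/-- All `u` for which `φ * U u` is square integrable. -/
def mulDomain (U : V ≃ₗᵢ[ℂ] Lp ℂ 2 μ) (φ : α → ℂ) : Submodule ℂ V where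
  carrier := {u | MemLp (fun x => φ x * U u x) 2 μ}
  zero_mem' := by
    refine (memLp_congr_ae ?_).2 (MemLp.zero : MemLp (0 : α → ℂ) 2 μ)
    filter_upwards [Lp.coeFn_zero ℂ 2 μ] with x hx
    simp only [map_zero, hx, Pi.zero_apply, mul_zero]
  add_mem' := by
    intro f g hf hg
    refine (memLp_congr_ae ?_).2 (MemLp.add hf hg)
    filter_upwards [Lp.coeFn_add (U f) (U g)] with x hx
    simp only [map_add, hx, Pi.add_apply, mul_add]
  smul_mem' := by
    intro c f hf
    refine (memLp_congr_ae ?_).2 (MemLp.const_smul hf c)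
    filter_upwards [Lp.coeFn_smul c (U f)] with x hx
    simp only [map_smul, hx, Pi.smul_apply, smul_eq_mul]
    ring

/-- The operator on `V` which a unitary `U : V → L²` turns into multiplication by `φ`. -/
def mulOp (U : V ≃ₗᵢ[ℂ] Lp ℂ 2 μ) (φ : α → ℂ) : V →ₗ.[ℂ] V where
  domain := mulDomain U φ
  toFun := U.symm.toLinearEquiv.toLinearMap ∘ₗ
    { toFun := fun f => MemLp.toLp _ (show MemLp (fun x => φ x * U f x) 2 μ from f.2)
      map_add' := by
        intro f g
        rw [← MemLp.toLp_add]
        refine MemLp.toLp_congr _ _ ?_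
        filter_upwards [Lp.coeFn_add (U f) (U g)] with x hx
        simp only [Submodule.coe_add, map_add, hx, Pi.add_apply, mul_add]
      map_smul' := by
        intro c f
        rw [RingHom.id_apply, ← MemLp.toLp_const_smul]
        refine MemLp.toLp_congr _ _ ?_
        filter_upwards [Lp.coeFn_smul c (U f)] with x hx
        simp only [Submodule.coe_smul, map_smul, hx, Pi.smul_apply, smul_eq_mul]
        ring }

variable (U : V ≃ₗᵢ[ℂ] Lp ℂ 2 μ)

theorem mem_mulOp_domain {φ : α → ℂ} {u : V} :
    u ∈ (mulOp U φ).domain ↔ MemLp (fun x => φ x * U u x) 2 μ := Iff.rfl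

theorem coeFn_mulOp {φ : α → ℂ} (u : (mulOp U φ).domain) :
    U (mulOp U φ u) =ᵐ[μ] fun x => φ x * U u x := by
  have : U (mulOp U φ u) = MemLp.toLp _ u.2 := U.apply_symm_apply _
  rw [this]
  exact MemLp.coeFn_toLp _

theorem inner_mulOp {φ : α → ℂ} (v : V) (u : (mulOp U φ).domain) :
    ⟪v, mulOp U φ u⟫_ℂ = ∫ x, (starRingEnd ℂ) (U v x) * (φ x * U u x) ∂μ := by
  rw [← U.inner_map_map, L2_inner_eq_integral]
  refine integral_congr_ae ?_
  filter_upwards [coeFn_mulOp U u] with x hx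
  rw [hx]

/-- `u` is in the domain of `mulOp U φ`, with image `w`, when `U w = φ * U u`. -/
theorem mulOp_of_ae_eq {φ : α → ℂ} {u w : V} (h : U w =ᵐ[μ] fun x => φ x * U u x) :
    ∃ hu : u ∈ (mulOp U φ).domain, mulOp U φ ⟨u, hu⟩ = w := by
  have hu : u ∈ (mulOp U φ).domain := (memLp_congr_ae h).1 (Lp.memLp _)
  refine ⟨hu, U.injective (Lp.ext ?_)⟩
  exact (coeFn_mulOp U ⟨u, hu⟩).trans h.symm

theorem mulOp_isFormalAdjoint (m : α → ℝ) :
    (mulOp U fun x => (m x : ℂ)).IsFormalAdjoint (mulOp U fun x => (m x : ℂ)) := by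
  intro u v
  rw [← inner_conj_symm, inner_mulOp, inner_mulOp, ← integral_conj]
  refine integral_congr_ae (ae_of_all _ fun x => ?_)
  simp only [map_mul, Complex.conj_conj, Complex.conj_ofReal]
  ring

theorem exists_mulOp_add_smul_eq {m : α → ℝ} (hm : Measurable m) {c : ℂ} (hc : |c.im| = 1)
    (w : V) : ∃ u : (mulOp U fun x => (m x : ℂ)).domain,
      mulOp U (fun x => (m x : ℂ)) u + c • (u : V) = w := by
  have hne (x : α) : (1 : ℝ) ≤ ‖(m x : ℂ) + c‖ := by
    refine le_trans ?_ (Complex.abs_im_le_norm _)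
    simp [hc]
  have hne' (x : α) : (m x : ℂ) + c ≠ 0 := norm_pos_iff.1 (one_pos.trans_le (hne x))
  have hb : MemLp (fun x => ((m x : ℂ) + c)⁻¹) ⊤ μ := by
    refine memLp_top_of_bound (by fun_prop) 1 (ae_of_all _ fun x => ?_)
    rw [norm_inv]
    exact inv_le_one_of_one_le₀ (hne x)
  -- The resolvent: division by `m + c`, a bounded operation since `|m + c| ≥ |Im c| = 1`.
  let u : V := U.symm (mulL hb (U w))
  have hu : U u =ᵐ[μ] fun x => ((m x : ℂ) + c)⁻¹ * U w x := by
    rw [U.apply_symm_apply]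
    exact coeFn_mulL hb _
  have h1 : U (w - c • u) =ᵐ[μ] fun x => (m x : ℂ) * U u x := by
    rw [map_sub, map_smul]
    filter_upwards [Lp.coeFn_sub (U w) (c • U u), Lp.coeFn_smul c (U u), hu] with x h1 h2 h3
    rw [h1, Pi.sub_apply, h2, Pi.smul_apply, h3, smul_eq_mul]
    field_simp [hne' x]
    ring
  obtain ⟨hu, h⟩ := mulOp_of_ae_eq U h1
  exact ⟨⟨u, hu⟩, by rw [h]; simp⟩

theorem mulOp_isSelfAdjoint [CompleteSpace V] {m : α → ℝ} (hm : Measurable m) :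
    IsSelfAdjoint (mulOp U fun x => (m x : ℂ)) := by
  refine (mulOp_isFormalAdjoint U m).isSelfAdjoint
    (exists_mulOp_add_smul_eq U hm (by simp)) fun w => ?_
  obtain ⟨u, hu⟩ := exists_mulOp_add_smul_eq U hm (c := -Complex.I) (by simp) w
  exact ⟨u, by rw [← hu, neg_smul, sub_eq_add_neg]⟩

end Multiplication

/-! ### The spectral resolution of a multiplication operator -/

section MulResolution

variable {α : Type*} [MeasurableSpace α] {μ : Measure α}

theorem memLp_top_indicator_one {s : Set α} (hs : MeasurableSet s) :
    MemLp (s.indicator (1 : α → ℂ)) ⊤ μ := by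
  refine memLp_top_of_bound ((measurable_const.indicator hs).aestronglyMeasurable) 1
    (ae_of_all _ fun x => ?_)
  by_cases hx : x ∈ s <;> simp [hx]

/-- Multiplication by the indicator function of `s`, as a projection in `L²`. -/
def indicatorL {s : Set α} (hs : MeasurableSet s) : Lp ℂ 2 μ →L[ℂ] Lp ℂ 2 μ :=
  mulL (memLp_top_indicator_one hs)

theorem coeFn_indicatorL {s : Set α} (hs : MeasurableSet s) (f : Lp ℂ 2 μ) :
    indicatorL hs f =ᵐ[μ] s.indicator f := by
  filter_upwards [coeFn_mulL (memLp_top_indicator_one hs) f] with x hx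
  refine hx.trans ?_
  by_cases h : x ∈ s <;> simp [h]

theorem indicatorL_indicatorL {s t : Set α} (hs : MeasurableSet s) (ht : MeasurableSet t)
    (f : Lp ℂ 2 μ) : indicatorL hs (indicatorL ht f) = indicatorL (hs.inter ht) f := by
  refine Lp.ext ?_
  filter_upwards [coeFn_indicatorL hs (indicatorL ht f), coeFn_indicatorL ht f,
    coeFn_indicatorL (hs.inter ht) f] with x h1 h2 h3
  rw [h1, h3, ← Set.indicator_indicator]
  by_cases h : x ∈ s <;> simp [h, h2]

theorem inner_indicatorL {s : Set α} (hs : MeasurableSet s) (f g : Lp ℂ 2 μ) :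
    ⟪indicatorL hs f, g⟫_ℂ = ⟪f, indicatorL hs g⟫_ℂ := by
  rw [L2_inner_eq_integral, L2_inner_eq_integral]
  refine integral_congr_ae ?_
  filter_upwards [coeFn_indicatorL hs f, coeFn_indicatorL hs g] with x h1 h2
  rw [h1, h2]
  by_cases h : x ∈ s <;> simp [h]

/-- Dominated convergence with `|f|²` as the bound; countable generation of the filter is what that
theorem requires. -/
theorem tendsto_indicatorL {ι : Type*} {l : Filter ι} [l.IsCountablyGenerated] {s : ι → Set α}
    (hs : ∀ i, MeasurableSet (s i)) {t : Set α} (ht : MeasurableSet t)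
    (h : ∀ x, ∀ᶠ i in l, x ∈ s i ↔ x ∈ t) (f : Lp ℂ 2 μ) :
    Tendsto (fun i => indicatorL (hs i) f) l (𝓝 (indicatorL ht f)) := by
  rw [tendsto_iff_norm_sub_tendsto_zero]
  have key (i : ι) : ‖indicatorL (hs i) f - indicatorL ht f‖ ^ 2
      = ∫ x, ‖(s i).indicator f x - t.indicator f x‖ ^ 2 ∂μ := by
    rw [L2_norm_sq]
    refine integral_congr_ae ?_
    filter_upwards [coeFn_indicatorL (hs i) f, coeFn_indicatorL ht f,
      Lp.coeFn_sub (indicatorL (hs i) f) (indicatorL ht f)] with x h1 h2 h3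
    rw [h3, Pi.sub_apply, h1, h2]
  have hlim : Tendsto (fun i => ‖indicatorL (hs i) f - indicatorL ht f‖ ^ 2) l (𝓝 0) := by
    simp only [key]
    have h0 : (0 : ℝ) = ∫ _ : α, (0 : ℝ) ∂μ := by simp
    rw [h0]
    refine tendsto_integral_filter_of_dominated_convergence (fun x => ‖f x‖ ^ 2) ?_ ?_ ?_ ?_
    · refine Eventually.of_forall fun i => ?_
      exact ((((Lp.stronglyMeasurable f).indicator (hs i)).sub
        ((Lp.stronglyMeasurable f).indicator ht)).norm.pow 2).aestronglyMeasurable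
    · refine Eventually.of_forall fun i => ae_of_all _ fun x => ?_
      by_cases h1 : x ∈ s i <;> by_cases h2 : x ∈ t <;> simp [h1, h2]
    · exact (memLp_two_iff_integrable_sq_norm (Lp.aestronglyMeasurable f)).1 (Lp.memLp f)
    · refine ae_of_all _ fun x => tendsto_const_nhds.congr' ?_
      filter_upwards [h x] with i hi
      by_cases h2 : x ∈ t <;> simp [h2, hi]
  have := hlim.sqrt
  simpa [Real.sqrt_sq (norm_nonneg _)] using this

theorem indicatorL_empty (f : Lp ℂ 2 μ) : indicatorL MeasurableSet.empty f = 0 := by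
  refine Lp.ext ?_
  filter_upwards [coeFn_indicatorL MeasurableSet.empty f, Lp.coeFn_zero ℂ 2 μ] with x h1 h2
  rw [h1, h2]
  simp

theorem indicatorL_univ (f : Lp ℂ 2 μ) : indicatorL MeasurableSet.univ f = f := by
  refine Lp.ext ?_
  filter_upwards [coeFn_indicatorL MeasurableSet.univ f] with x h1
  rw [h1]
  simp

variable {V : Type*} [NormedAddCommGroup V] [InnerProductSpace ℂ V]

/-- The projection `U⁻¹ 1_{m ≤ x} U`. -/
def mulProj (U : V ≃ₗᵢ[ℂ] Lp ℂ 2 μ) {m : α → ℝ} (hm : Measurable m) (x : ℝ) : V →L[ℂ] V :=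
  (U.symm.toContinuousLinearEquiv : Lp ℂ 2 μ →L[ℂ] V) ∘L
    indicatorL (measurableSet_le hm (measurable_const (a := x))) ∘L
    (U.toContinuousLinearEquiv : V →L[ℂ] Lp ℂ 2 μ)

theorem mulProj_apply (U : V ≃ₗᵢ[ℂ] Lp ℂ 2 μ) {m : α → ℝ} (hm : Measurable m) (x : ℝ) (u : V) :
    mulProj U hm x u
      = U.symm (indicatorL (measurableSet_le hm (measurable_const (a := x))) (U u)) := rfl

theorem mulProj_mulProj (U : V ≃ₗᵢ[ℂ] Lp ℂ 2 μ) {m : α → ℝ} (hm : Measurable m) {x y : ℝ}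
    (hxy : x ≤ y) : mulProj U hm x * mulProj U hm y = mulProj U hm x := by
  ext u
  have : {a | m a ≤ x} ∩ {a | m a ≤ y} = {a | m a ≤ x} :=
    Set.inter_eq_left.2 fun a ha => le_trans ha hxy
  rw [mul_apply_eq_comp]
  simp only [mulProj_apply]
  rw [U.apply_symm_apply, indicatorL_indicatorL]
  simp only [this]

/-- If the sets `{m ≤ s i}` converge pointwise to `t`, then so do the projections. -/
theorem tendsto_mulProj (U : V ≃ₗᵢ[ℂ] Lp ℂ 2 μ) {m : α → ℝ} (hm : Measurable m)
    {l : Filter ℝ} [l.IsCountablyGenerated] {t : Set α} (ht : MeasurableSet t)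
    (h : ∀ a, ∀ᶠ y in l, m a ≤ y ↔ a ∈ t) (u : V) :
    Tendsto (fun y => mulProj U hm y u) l (𝓝 (U.symm (indicatorL ht (U u)))) :=
  (U.symm.continuous.tendsto _).comp
    (tendsto_indicatorL (fun y => measurableSet_le hm (measurable_const (a := y))) ht h (U u))

variable [CompleteSpace V]

theorem isSelfAdjoint_mulProj (U : V ≃ₗᵢ[ℂ] Lp ℂ 2 μ) {m : α → ℝ} (hm : Measurable m) (x : ℝ) :
    IsSelfAdjoint (mulProj U hm x) := by
  rw [ContinuousLinearMap.isSelfAdjoint_iff_isSymmetric]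
  intro u v
  change ⟪mulProj U hm x u, v⟫_ℂ = ⟪u, mulProj U hm x v⟫_ℂ
  rw [← U.inner_map_map, ← U.inner_map_map u, mulProj_apply, mulProj_apply, U.apply_symm_apply,
    U.apply_symm_apply, inner_indicatorL]

/-- The resolution of the identity given by the projections `U⁻¹ 1_{m ≤ x} U`. -/
def mulResolution (U : V ≃ₗᵢ[ℂ] Lp ℂ 2 μ) {m : α → ℝ} (hm : Measurable m) :
    ResolutionOfIdentity V where
  proj := mulProj U hm
  isStarProjection x := ⟨mulProj_mulProj U hm le_rfl, isSelfAdjoint_mulProj U hm x⟩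
  proj_mul_proj x y hxy := mulProj_mulProj U hm hxy
  tendsto_right x u := by
    refine tendsto_mulProj U hm (measurableSet_le hm measurable_const) (fun a => ?_) u
    rcases le_or_gt (m a) x with h | h
    · filter_upwards [self_mem_nhdsWithin] with y hy
      exact iff_of_true (h.trans (le_of_lt hy)) h
    · filter_upwards [mem_nhdsWithin_of_mem_nhds (Iio_mem_nhds h)] with y hy
      exact iff_of_false (not_le.2 hy) (not_le.2 h)
  tendsto_atBot u := by
    have h := tendsto_mulProj U hm (l := atBot) MeasurableSet.empty
      (fun a => by
        filter_upwards [Iio_mem_atBot (m a)] with y hy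
        simpa using hy) u
    rwa [indicatorL_empty, map_zero] at h
  tendsto_atTop u := by
    have h := tendsto_mulProj U hm (l := atTop) MeasurableSet.univ
      (fun a => by
        filter_upwards [Ici_mem_atTop (m a)] with y hy
        simpa using hy) u
    rwa [indicatorL_univ, U.symm_apply_apply] at h

variable (U : V ≃ₗᵢ[ℂ] Lp ℂ 2 μ) {m : α → ℝ} (hm : Measurable m)

theorem mulResolution_proj_apply (x : ℝ) (u : V) :
    U ((mulResolution U hm).proj x u) =ᵐ[μ] {a | m a ≤ x}.indicator (U u) := by
  have : U ((mulResolution U hm).proj x u)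
      = indicatorL (measurableSet_le hm (measurable_const (a := x))) (U u) :=
    U.apply_symm_apply _
  rw [this]
  exact coeFn_indicatorL _ _

theorem measurable_enorm_sq (f : Lp ℂ 2 μ) : Measurable fun x => ‖f x‖ₑ ^ 2 :=
  (Lp.stronglyMeasurable f).measurable.enorm.pow_const 2

/-- Both measures give `(-∞, x]` the mass `∫_{m ≤ x} |U u|²`. Every later spectral integral reduces
to an integral over `α` through this. -/
theorem mulResolution_distribution (u : V) :
    (mulResolution U hm).distribution u = (μ.withDensity fun x => ‖U u x‖ₑ ^ 2).map m := by
  refine Measure.ext_of_Iic _ _ fun x => ?_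
  have hs : MeasurableSet {a | m a ≤ x} := measurableSet_le hm measurable_const
  rw [ResolutionOfIdentity.distribution_Iic, Measure.map_apply hm measurableSet_Iic,
    withDensity_apply _ (hm measurableSet_Iic), ← U.norm_map, L2_ofReal_norm_sq,
    ← lintegral_indicator (hm measurableSet_Iic)]
  refine lintegral_congr_ae ?_
  filter_upwards [mulResolution_proj_apply U hm x u] with a ha
  rw [ha]
  by_cases h : m a ≤ x
  · rw [Set.indicator_of_mem (by exact h), Set.indicator_of_mem (by exact h)]
  · rw [Set.indicator_of_notMem (by exact h), Set.indicator_of_notMem (by exact h)]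
    simp

theorem memLp_mulResolution_distribution {φ : ℝ → ℂ} (hφ : Measurable φ) (u : V) :
    MemLp φ 2 ((mulResolution U hm).distribution u) ↔
      u ∈ (mulOp U fun x => φ (m x)).domain := by
  rw [mulResolution_distribution, memLp_map_measure_iff hφ.aestronglyMeasurable hm.aemeasurable,
    memLp_two_iff_integrable_sq_norm (hφ.comp hm).aestronglyMeasurable,
    integrable_withDensity_iff_integrable_smul' (measurable_enorm_sq _)
      (ae_of_all _ fun x => by simp), mem_mulOp_domain,
    memLp_two_iff_integrable_sq_norm]
  · refine integrable_congr (ae_of_all _ fun x => ?_)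
    simp [mul_pow, mul_comm]
  · exact ((hφ.comp hm).mul (Lp.stronglyMeasurable _).measurable).aestronglyMeasurable

theorem integral_mulResolution_distribution {φ : ℝ → ℂ} (hφ : Measurable φ) (u : V) :
    ∫ x, φ x ∂(mulResolution U hm).distribution u
      = ∫ x, (starRingEnd ℂ) (U u x) * (φ (m x) * U u x) ∂μ := by
  rw [mulResolution_distribution, integral_map hm.aemeasurable hφ.aestronglyMeasurable,
    integral_withDensity_eq_integral_toReal_smul (measurable_enorm_sq _)
      (ae_of_all _ fun x => by simp)]
  refine integral_congr_ae (ae_of_all _ fun x => ?_)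
  have : (starRingEnd ℂ) (U u x) * (φ (m x) * U u x)
      = (starRingEnd ℂ) (U u x) * U u x * φ (m x) := by ring
  simp only [this, Complex.conj_mul']
  simp

/-- The integrals in the polarized sum are the quadratic form of the multiplication operator, so the
sum is the polarization identity for `⟨v, T u⟩`. -/
theorem mulResolution_isSpectralIntegral {φ : ℝ → ℂ} (hφ : Measurable φ) :
    (mulResolution U hm).IsSpectralIntegral φ (mulOp U fun x => φ (m x)) := by
  refine ⟨fun u => (memLp_mulResolution_distribution U hm hφ u).symm, fun v u => ?_⟩
  have key (k : ℕ) : ∫ x, φ x ∂(mulResolution U hm).distribution ((u : V) + Complex.I ^ k • (v : V))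
      = ⟪(u : V) + Complex.I ^ k • (v : V), mulOp U (fun x => φ (m x)) (u + Complex.I ^ k • v)⟫_ℂ := by
    rw [integral_mulResolution_distribution U hm hφ, inner_mulOp]
    rfl
  simp only [ResolutionOfIdentity.sesqIntegral, key, LinearPMap.map_add, LinearPMap.map_smul,
    inner_add_left, inner_add_right, inner_smul_left, inner_smul_right, Finset.sum_range_succ,
    Finset.sum_range_zero]
  simp [pow_succ]
  ring_nf
  simp
  ring

theorem mulResolution_isExp (t : ℝ) : ∃ T : V →L[ℂ] V, (mulResolution U hm).IsExp t T := by
  have hφ : Measurable fun x : ℝ => Complex.exp (Complex.I * t * x) := by fun_prop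
  have hb : MemLp (fun x => Complex.exp (Complex.I * t * m x)) ⊤ μ := by
    refine memLp_top_of_bound (hφ.comp hm).aestronglyMeasurable 1 (ae_of_all _ fun x => ?_)
    rw [show Complex.I * t * m x = ((t * m x : ℝ) : ℂ) * Complex.I by push_cast; ring,
      Complex.norm_exp_ofReal_mul_I]
  let T : V →L[ℂ] V := (U.symm.toContinuousLinearEquiv : Lp ℂ 2 μ →L[ℂ] V) ∘L mulL hb ∘L
    (U.toContinuousLinearEquiv : V →L[ℂ] Lp ℂ 2 μ)
  have hT (u : V) : U (T u) =ᵐ[μ] fun x => Complex.exp (Complex.I * t * m x) * U u x := by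
    have : U (T u) = mulL hb (U u) := U.apply_symm_apply _
    rw [this]
    exact coeFn_mulL hb _
  have h := mulResolution_isSpectralIntegral U hm hφ
  have hdom (u : V) := mulOp_of_ae_eq U (hT u)
  refine ⟨T, fun u => ⟨fun _ => (h.1 u).1 (hdom u).1, fun _ => trivial⟩, fun v u => ?_⟩
  rw [← h.2 ⟨v, (hdom v).1⟩ ⟨u, (hdom u).1⟩, (hdom u).2]
  rfl

end MulResolution

/-! ### Uniqueness of the spectral resolution of a multiplication operator -/

section Uniqueness

variable {α : Type*} [MeasurableSpace α] {μ : Measure α}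
  {V : Type*} [NormedAddCommGroup V] [InnerProductSpace ℂ V] [CompleteSpace V]
  (U : V ≃ₗᵢ[ℂ] Lp ℂ 2 μ) {m : α → ℝ} (hm : Measurable m) {E : ResolutionOfIdentity V}


theorem mulResolution_proj (x : ℝ) : (mulResolution U hm).proj x = mulProj U hm x := rfl

theorem mulProj_eq_self {y : ℝ} {u : V} (h : ∀ᵐ x ∂μ, U u x ≠ 0 → m x ≤ y) :
    mulProj U hm y u = u := by
  refine U.injective (Lp.ext ?_)
  filter_upwards [mulResolution_proj_apply U hm y u, h] with x hx h
  rw [← mulResolution_proj, hx]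
  by_cases h0 : U u x = 0
  · simp [Set.indicator_apply, h0]
  · exact Set.indicator_of_mem (by exact h h0) _

theorem mulProj_eq_zero {y : ℝ} {u : V} (h : ∀ᵐ x ∂μ, U u x ≠ 0 → y < m x) :
    mulProj U hm y u = 0 := by
  refine U.injective (Lp.ext ?_)
  rw [map_zero]
  filter_upwards [mulResolution_proj_apply U hm y u, h, Lp.coeFn_zero ℂ 2 μ] with x hx h hz
  rw [← mulResolution_proj, hx, hz]
  by_cases h0 : U u x = 0
  · simp [Set.indicator_apply, h0]
  · exact Set.indicator_of_notMem (by simpa using h h0) _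

namespace ResolutionOfIdentity

variable {U}

/-- The witness is `(A - (a + b) / 2)^n u`: the spectral subspace is invariant, so the norm bound
iterates, while `U` shows the same vector as a power of a function. -/
theorem IsSpectralResolution.exists_pow (hm : Measurable m)
    (hA : E.IsSpectralResolution (mulOp U fun x => (m x : ℂ))) {a b : ℝ} (hab : a ≤ b) {u : V}
    (hu : u ∈ E.spectralSubspace a b) (n : ℕ) :
    ∃ w ∈ E.spectralSubspace a b, ‖w‖ ≤ ((b - a) / 2) ^ n * ‖u‖ ∧
      U w =ᵐ[μ] fun x => ((m x - (a + b) / 2 : ℝ) : ℂ) ^ n * U u x := by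
  have hd := (mulOp_isSelfAdjoint U hm).dense_domain
  induction n with
  | zero => exact ⟨u, hu, by simp, ae_of_all _ fun x => by simp⟩
  | succ n ih =>
    obtain ⟨w, hw, hn, hU⟩ := ih
    let w' : (mulOp U fun x => (m x : ℂ)).domain := ⟨w, hA.spectralSubspace_le_domain a b hw⟩
    refine ⟨mulOp U (fun x => (m x : ℂ)) w' - (((a + b) / 2 : ℝ) : ℂ) • w,
      Submodule.sub_mem _ (hA.apply_mem_spectralSubspace hd w' hw) (Submodule.smul_mem _ _ hw),
      ?_, ?_⟩
    · refine (hA.norm_sub_le hd (mulOp_isFormalAdjoint U m) w' hw).trans ?_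
      rw [pow_succ', mul_assoc]
      exact mul_le_mul_of_nonneg_left hn (by linarith)
    · rw [map_sub, map_smul]
      filter_upwards [coeFn_mulOp U w', hU,
        Lp.coeFn_sub (U (mulOp U (fun x => (m x : ℂ)) w')) ((((a + b) / 2 : ℝ) : ℂ) • U w),
        Lp.coeFn_smul (((a + b) / 2 : ℝ) : ℂ) (U w)] with x h1 h2 h3 h4
      rw [h3, Pi.sub_apply, h1, h4, Pi.smul_apply, smul_eq_mul, ← sub_mul, h2]
      push_cast
      ring

/-- On the set where `|m - (a + b) / 2| ≥ ρ`, the `n`-th power is at least `ρ^n |U u|`, but its norm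
is at most `((b - a) / 2)^n ‖u‖`. The ratio tends to zero. -/
theorem IsSpectralResolution.ae_eq_zero_of_lt (hm : Measurable m)
    (hA : E.IsSpectralResolution (mulOp U fun x => (m x : ℂ))) {a b : ℝ} (hab : a ≤ b) {u : V}
    (hu : u ∈ E.spectralSubspace a b) {ρ : ℝ} (hρ : (b - a) / 2 < ρ) :
    ∀ᵐ x ∂μ, ρ ≤ |m x - (a + b) / 2| → U u x = 0 := by
  have hr : 0 ≤ (b - a) / 2 := by linarith
  have hρ0 : 0 < ρ := hr.trans_lt hρ
  have hs : MeasurableSet {x | ρ ≤ |m x - (a + b) / 2|} :=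
    measurableSet_le measurable_const (by fun_prop)
  have hn (n : ℕ) : ‖indicatorL hs (U u)‖ ≤ ((b - a) / 2 / ρ) ^ n * ‖u‖ := by
    obtain ⟨w, -, hw, hU⟩ := hA.exists_pow hm hab hu n
    have h1 : ‖((ρ ^ n : ℝ) : ℂ) • indicatorL hs (U u)‖ ≤ ‖U w‖ := by
      refine Lp.norm_le_norm_of_ae_le ?_
      filter_upwards [hU, Lp.coeFn_smul ((ρ ^ n : ℝ) : ℂ) (indicatorL hs (U u)),
        coeFn_indicatorL hs (U u)] with x h1 h2 h3
      rw [h1, h2, Pi.smul_apply, h3, norm_smul, norm_mul, norm_pow, Complex.norm_real,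
        Complex.norm_real, Real.norm_of_nonneg (by positivity), Real.norm_eq_abs]
      by_cases hx : x ∈ {x | ρ ≤ |m x - (a + b) / 2|}
      · rw [Set.indicator_of_mem hx]
        exact mul_le_mul_of_nonneg_right (pow_le_pow_left₀ hρ0.le hx n) (norm_nonneg _)
      · rw [Set.indicator_of_notMem hx, norm_zero, mul_zero]
        positivity
    rw [norm_smul, Complex.norm_real, Real.norm_of_nonneg (by positivity), U.norm_map] at h1
    rw [div_pow, div_mul_eq_mul_div, le_div_iff₀ (by positivity), mul_comm]
    exact h1.trans hw
  have hlim : Tendsto (fun n : ℕ => ((b - a) / 2 / ρ) ^ n * ‖u‖) atTop (𝓝 (0 * ‖u‖)) :=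
    (tendsto_pow_atTop_nhds_zero_of_lt_one (by positivity) ((div_lt_one hρ0).2 hρ)).mul_const _
  rw [zero_mul] at hlim
  have h0 : indicatorL hs (U u) = 0 := norm_le_zero_iff.1 (ge_of_tendsto' hlim hn)
  filter_upwards [coeFn_indicatorL hs (U u), Lp.coeFn_zero ℂ 2 μ] with x h1 h2 hx
  rw [h0, h2, Set.indicator_of_mem (by exact hx)] at h1
  exact h1.symm

theorem IsSpectralResolution.ae_mem_Icc (hm : Measurable m)
    (hA : E.IsSpectralResolution (mulOp U fun x => (m x : ℂ))) {a b : ℝ} (hab : a ≤ b) {u : V}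
    (hu : u ∈ E.spectralSubspace a b) : ∀ᵐ x ∂μ, U u x ≠ 0 → m x ∈ Set.Icc a b := by
  have h : ∀ᵐ x ∂μ, ∀ n : ℕ, (b - a) / 2 + 1 / ((n : ℝ) + 1) ≤ |m x - (a + b) / 2| → U u x = 0 :=
    ae_all_iff.2 fun n => hA.ae_eq_zero_of_lt hm hab hu (by
      have : (0 : ℝ) < 1 / ((n : ℝ) + 1) := by positivity
      linarith)
  filter_upwards [h] with x hx h0
  have hle : |m x - (a + b) / 2| ≤ (b - a) / 2 := by
    by_contra! hlt
    obtain ⟨n, hn⟩ := exists_nat_one_div_lt (sub_pos.2 hlt)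
    exact h0 (hx n (by linarith))
  rw [abs_le] at hle
  constructor <;> linarith [hle.1, hle.2]

theorem IsSpectralResolution.eq_mulResolution (hm : Measurable m)
    (hA : E.IsSpectralResolution (mulOp U fun x => (m x : ℂ))) : E = mulResolution U hm := by
  -- With `F` the indicator projections, `F_y E_y = E_y`: approximate `E_y u` by `E_y u - E_a u` as
  -- `a → -∞`, a vector supported in `{m ≤ y}`.
  have h1 (y : ℝ) (u : V) : mulProj U hm y (E.proj y u) = E.proj y u := by
    have hlim : Tendsto (fun a => E.proj y u - E.proj a u) atBot (𝓝 (E.proj y u)) := by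
      simpa using (tendsto_const_nhds (x := E.proj y u)).sub (E.tendsto_atBot u)
    refine tendsto_nhds_unique (((mulProj U hm y).continuous.tendsto _).comp hlim)
      (hlim.congr' ?_)
    filter_upwards [Iic_mem_atBot y] with a ha
    refine (mulProj_eq_self U hm ?_).symm
    filter_upwards [hA.ae_mem_Icc hm ha (proj_sub_proj_mem_spectralSubspace E ha u)] with x hx h0
    exact (hx h0).2
  -- `F_z E_y = F_z`, since `u - E_y u` is supported in `{m ≥ y}`. Strictness of `z < y` is needed
  -- because the support statement includes the endpoint.
  have h2 (z y : ℝ) (hzy : z < y) (u : V) : mulProj U hm z (E.proj y u) = mulProj U hm z u := by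
    have hlim : Tendsto (fun b => E.proj b u - E.proj y u) atTop (𝓝 (u - E.proj y u)) :=
      (E.tendsto_atTop u).sub tendsto_const_nhds
    have h := tendsto_nhds_unique (((mulProj U hm z).continuous.tendsto _).comp hlim)
      (tendsto_const_nhds.congr' (f₁ := fun _ => 0) ?_)
    · rw [map_sub, sub_eq_zero] at h
      exact h.symm
    filter_upwards [Ici_mem_atTop y] with b hb
    refine (mulProj_eq_zero U hm ?_).symm
    filter_upwards [hA.ae_mem_Icc hm hb (proj_sub_proj_mem_spectralSubspace E hb u)] with x hx h0
    exact hzy.trans_le (hx h0).1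
  refine ext_proj fun z => ?_
  ext u
  -- It remains to show `F_z E_z u = F_z u`. By `h2`, `F_z E_y u` equals `F_z u` for all `y > z`,
  -- and right continuity of `E` covers `y = z`.
  rw [mulResolution_proj, ← h1]
  refine tendsto_nhds_unique
    (((mulProj U hm z).continuous.tendsto _).comp (E.tendsto_right z u))
    (tendsto_const_nhds.congr' ?_)
  filter_upwards [self_mem_nhdsWithin] with y hy
  exact (h2 z y hy u).symm

end ResolutionOfIdentity

end Uniqueness

/-! ### Cores of self-adjoint operators -/

section Core

variable {V : Type*} [NormedAddCommGroup V] [InnerProductSpace ℂ V]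

theorem LinearPMap.IsFormalAdjoint.norm_add_I_smul_sq {A : V →ₗ.[ℂ] V} (hs : A.IsFormalAdjoint A)
    (x : A.domain) : ‖A x + Complex.I • (x : V)‖ ^ 2 = ‖A x‖ ^ 2 + ‖(x : V)‖ ^ 2 := by
  have h := hs.inner_self_im x
  have h1 : (⟪A x, (x : V)⟫_ℂ).im = 0 := by rw [hs x x]; exact h
  rw [norm_add_sq (𝕜 := ℂ), inner_smul_right, norm_smul]
  simp [h1]

/-- One inclusion holds because `A` is closed. For the other, choose `xₙ` in the domain of `B` with
`(B + i) xₙ → (A + i) u`; the identity `‖(A + i) x‖² = ‖A x‖² + ‖x‖²` forces `xₙ → u` and `B xₙ → A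
u`. -/
theorem LinearPMap.closure_eq_of_dense_range [CompleteSpace V] {A B : V →ₗ.[ℂ] V}
    (hA : IsSelfAdjoint A) (hs : A.IsFormalAdjoint A) (hle : B ≤ A)
    (hd : Dense (Set.range fun x : B.domain => B x + Complex.I • (x : V))) : B.closure = A := by
  have hcl : A.IsClosed := hA.isClosed
  have hB : B.IsClosable := hcl.isClosable.leIsClosable hle
  refine LinearPMap.eq_of_eq_graph (le_antisymm ?_ ?_)
  · rw [← hB.graph_closure_eq_closure_graph]
    exact Submodule.topologicalClosure_minimal _ (LinearPMap.le_graph_of_le hle) hcl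
  rw [← hB.graph_closure_eq_closure_graph]
  rintro ⟨u, w⟩ huw
  rw [LinearPMap.mem_graph_iff] at huw
  obtain ⟨u, rfl, rfl⟩ := huw
  obtain ⟨y, hy, hlim⟩ := mem_closure_iff_seq_limit.1 (hd (A u + Complex.I • (u : V)))
  choose x hx using hy
  let x' (n : ℕ) : A.domain := ⟨x n, hle.1 (x n).2⟩
  have hx' (n : ℕ) : A (x' n) = B (x n) := (hle.2 rfl).symm
  have hsub : Tendsto (fun n => A (x' n - u) + Complex.I • ((x' n - u : A.domain) : V))
      atTop (𝓝 0) := by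
    have := hlim.sub_const (A u + Complex.I • (u : V))
    rw [sub_self] at this
    refine this.congr fun n => ?_
    have hxn : ((x' n : A.domain) : V) = x n := rfl
    rw [← hx n, LinearPMap.map_sub, hx', AddSubgroupClass.coe_sub, smul_sub, hxn]
    dsimp only
    abel
  have hn1 (n : ℕ) := hs.norm_add_I_smul_sq (x' n - u)
  have t1 : Tendsto (fun n => ((x' n - u : A.domain) : V)) atTop (𝓝 0) := by
    refine squeeze_zero_norm (fun n => ?_) (tendsto_zero_iff_norm_tendsto_zero.1 hsub)
    exact abs_le_of_sq_le_sq' (by nlinarith [hn1 n, sq_nonneg ‖A (x' n - u)‖]) (norm_nonneg _) |>.2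
  have t2 : Tendsto (fun n => A (x' n - u)) atTop (𝓝 0) := by
    refine squeeze_zero_norm (fun n => ?_) (tendsto_zero_iff_norm_tendsto_zero.1 hsub)
    exact abs_le_of_sq_le_sq'
      (by nlinarith [hn1 n, sq_nonneg ‖((x' n - u : A.domain) : V)‖]) (norm_nonneg _) |>.2
  refine mem_closure_of_tendsto (f := fun n => ((x n : V), B (x n))) (b := atTop) ?_
    (Eventually.of_forall fun n => B.mem_graph (x n))
  refine Tendsto.prodMk_nhds ?_ ?_
  · have := t1.add_const (u : V)
    rw [zero_add] at this
    exact this.congr fun n => by simp [x']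
  · have := t2.add_const (A u)
    rw [zero_add] at this
    exact this.congr fun n => by rw [LinearPMap.map_sub, hx', sub_add_cancel]

end Core

/-! ### Integration by parts for absolutely continuous functions on `ℝ` -/

section ByParts

/-- Integrability of the derivative gives `G` limits at `±∞`. Both are zero, because `G` is
integrable and half-lines have infinite measure. -/
theorem integral_deriv_eq_zero_of_ac_real {G : ℝ → ℝ}
    (hG : ∀ a b : ℝ, AbsolutelyContinuousOnInterval G a b) (hi : Integrable G)
    (hi' : Integrable (deriv G)) : ∫ x, deriv G x = 0 := by
  have h1 : Tendsto G atTop (𝓝 (G 0 + ∫ x in Set.Ioi 0, deriv G x)) := by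
    refine ((intervalIntegral_tendsto_integral_Ioi 0 hi'.integrableOn tendsto_id).const_add
      (G 0)).congr fun b => ?_
    simp [(hG 0 b).integral_deriv_eq_sub]
  have h2 : Tendsto G atBot (𝓝 (G 0 - ∫ x in Set.Iic 0, deriv G x)) := by
    refine ((intervalIntegral_tendsto_integral_Iic 0 hi'.integrableOn tendsto_id).const_sub
      (G 0)).congr fun b => ?_
    simp [(hG b 0).integral_deriv_eq_sub]
  have h1' := (hi.integrableAtFilter atTop).eq_zero_of_tendsto (fun s hs => by
    obtain ⟨b, hb⟩ := mem_atTop_sets.1 hs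
    rw [← top_le_iff, ← Real.volume_Ici (a := b)]
    exact measure_mono hb) h1
  have h2' := (hi.integrableAtFilter atBot).eq_zero_of_tendsto (fun s hs => by
    obtain ⟨b, hb⟩ := mem_atBot_sets.1 hs
    rw [← top_le_iff, ← Real.volume_Iic (a := b)]
    exact measure_mono hb) h2
  rw [← intervalIntegral.integral_Iic_add_Ioi (b := 0) hi'.integrableOn hi'.integrableOn]
  linarith

theorem AbsolutelyContinuousOnInterval.clm_comp {E F : Type*} [NormedAddCommGroup E]
    [NormedSpace ℝ E] [NormedAddCommGroup F] [NormedSpace ℝ F] (L : E →L[ℝ] F) {G : ℝ → E}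
    {a b : ℝ} (hG : AbsolutelyContinuousOnInterval G a b) :
    AbsolutelyContinuousOnInterval (fun x => L (G x)) a b := by
  refine squeeze_zero (fun t => Finset.sum_nonneg fun i _ => dist_nonneg) (fun t => ?_)
    (by simpa using Tendsto.const_mul ‖L‖ hG)
  rw [Finset.mul_sum]
  refine Finset.sum_le_sum fun i _ => ?_
  rw [dist_eq_norm, dist_eq_norm, ← map_sub]
  exact L.le_opNorm _

theorem ae_differentiableAt_of_ac {E : Type*} [NormedAddCommGroup E] [NormedSpace ℝ E]
    [FiniteDimensional ℝ E] {G : ℝ → E}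
    (hG : ∀ a b : ℝ, AbsolutelyContinuousOnInterval G a b) : ∀ᵐ x, DifferentiableAt ℝ G x := by
  have : ∀ᵐ x, ∀ n : ℕ, x ∈ Set.uIcc (-(n : ℝ)) n → DifferentiableAt ℝ G x :=
    ae_all_iff.2 fun n => (hG _ _).boundedVariationOn.ae_differentiableAt_of_mem_uIcc
  filter_upwards [this] with x hx
  obtain ⟨n, hn⟩ := exists_nat_ge |x|
  refine hx n ?_
  rw [Set.uIcc_of_le (by linarith [abs_nonneg x])]
  exact ⟨(abs_le.1 hn).1, (abs_le.1 hn).2⟩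

theorem integral_deriv_eq_zero_of_ac {G : ℝ → ℂ}
    (hG : ∀ a b : ℝ, AbsolutelyContinuousOnInterval G a b) (hi : Integrable G)
    (hi' : Integrable (deriv G)) : ∫ x, deriv G x = 0 := by
  have key (L : ℂ →L[ℝ] ℝ) : L (∫ x, deriv G x) = 0 := by
    have hae : (fun x => L (deriv G x)) =ᵐ[volume] deriv fun x => L (G x) := by
      filter_upwards [ae_differentiableAt_of_ac hG] with x hx
      exact (L.hasFDerivAt.comp_hasDerivAt x hx.hasDerivAt).deriv.symm
    rw [← L.integral_comp_comm hi', integral_congr_ae hae]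
    exact integral_deriv_eq_zero_of_ac_real (fun a b => (hG a b).clm_comp L)
      (L.integrable_comp hi) ((L.integrable_comp hi').congr hae)
  exact Complex.ext (key Complex.reCLM) (key Complex.imCLM)

theorem integral_conj_mul_deriv_eq_neg {s g : ℝ → ℂ} (hs : ContDiff ℝ 1 s)
    (hs2 : MemLp s 2 volume) (hs2' : MemLp (deriv s) 2 volume)
    (hg : ∀ a b : ℝ, AbsolutelyContinuousOnInterval g a b)
    (hg2 : MemLp g 2 volume) (hg2' : MemLp (deriv g) 2 volume) :
    ∫ x, (starRingEnd ℂ) (s x) * deriv g x = -∫ x, (starRingEnd ℂ) (deriv s x) * g x := by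
  have hsc : ContDiff ℝ 1 fun x => (starRingEnd ℂ) (s x) :=
    Complex.conjCLE.contDiff.comp hs
  have hG (a b : ℝ) : AbsolutelyContinuousOnInterval
      ((fun x => (starRingEnd ℂ) (s x)) • g) a b :=
    hsc.contDiffOn.absolutelyContinuousOnInterval.smul (hg a b)
  have hae : deriv ((fun x => (starRingEnd ℂ) (s x)) • g) =ᵐ[volume] fun x =>
      (starRingEnd ℂ) (s x) * deriv g x + (starRingEnd ℂ) (deriv s x) * g x := by
    filter_upwards [ae_differentiableAt_of_ac hg] with x hx
    have h1 : HasDerivAt s (deriv s x) x := (hs.differentiable one_ne_zero x).hasDerivAt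
    have h2 : HasDerivAt (fun x => (starRingEnd ℂ) (s x)) ((starRingEnd ℂ) (deriv s x)) x :=
      Complex.conjCLE.toContinuousLinearMap.hasFDerivAt.comp_hasDerivAt x h1
    rw [(h2.smul hx.hasDerivAt).deriv]
    simp [smul_eq_mul]
  have hi1 : Integrable fun x => (starRingEnd ℂ) (s x) * deriv g x :=
    hs2.star.integrable_mul hg2'
  have hi2 : Integrable fun x => (starRingEnd ℂ) (deriv s x) * g x :=
    hs2'.star.integrable_mul hg2
  have h0 := integral_deriv_eq_zero_of_ac hG (hs2.star.integrable_mul hg2)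
    ((hi1.add hi2).congr hae.symm)
  rw [integral_congr_ae hae, integral_add hi1 hi2] at h0
  exact eq_neg_of_add_eq_zero_left h0

end ByParts

/-! ### The unitary diagonalizing `X + P` -/

section Diagonalization

open SchwartzMap FourierTransform

/-- The chirp `e^{ix²/2}`. -/
def chirp (x : ℝ) : ℂ := Complex.exp (((x ^ 2 / 2 : ℝ) : ℂ) * Complex.I)

theorem norm_chirp (x : ℝ) : ‖chirp x‖ = 1 := Complex.norm_exp_ofReal_mul_I _

theorem contDiff_chirp {n : WithTop ℕ∞} : ContDiff ℝ n chirp := by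
  unfold chirp
  exact ((Complex.ofRealCLM.contDiff.comp ((contDiff_id.pow 2).div_const 2)).mul contDiff_const).cexp

theorem hasDerivAt_chirp (x : ℝ) : HasDerivAt chirp (Complex.I * x * chirp x) x := by
  have h1 : HasDerivAt (fun x : ℝ => x ^ 2 / 2) x x := by
    simpa using (hasDerivAt_pow 2 x).div_const 2
  have h := (h1.ofReal_comp.mul_const Complex.I).cexp
  refine h.congr_deriv ?_
  change Complex.exp _ * _ = Complex.I * x * Complex.exp _
  ring

theorem conj_chirp_mul (x : ℝ) : (starRingEnd ℂ) (chirp x) * chirp x = 1 := by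
  rw [Complex.conj_mul', norm_chirp]
  simp

theorem hasDerivAt_conj_chirp (x : ℝ) : HasDerivAt (fun x => (starRingEnd ℂ) (chirp x))
    (-(Complex.I * x * (starRingEnd ℂ) (chirp x))) x := by
  have := Complex.conjCLE.toContinuousLinearMap.hasFDerivAt.comp_hasDerivAt x (hasDerivAt_chirp x)
  refine this.congr_deriv ?_
  simp

theorem memLp_top_chirp : MemLp chirp ⊤ (volume : Measure ℝ) :=
  memLp_top_of_bound (contDiff_chirp (n := 0)).continuous.aestronglyMeasurable 1
    (ae_of_all _ fun x => (norm_chirp x).le)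

theorem mulL_mulL_of_inv {φ ψ : ℝ → ℂ} (hφ : MemLp φ ⊤ (volume : Measure ℝ))
    (hψ : MemLp ψ ⊤ (volume : Measure ℝ)) (h : ∀ x, φ x * ψ x = 1) (f : L2R) :
    mulL hφ (mulL hψ f) = f := by
  refine Lp.ext ?_
  filter_upwards [coeFn_mulL hφ (mulL hψ f), coeFn_mulL hψ f] with x h1 h2
  rw [h1, h2, ← mul_assoc, h, one_mul]

/-- Multiplication by `e^{ix²/2}` as a unitary operator. -/
def chirpL : L2R ≃ₗᵢ[ℂ] L2R where
  toLinearEquiv := LinearEquiv.ofLinearMap (mulL memLp_top_chirp).toLinearMap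
    (mulL memLp_top_chirp.star).toLinearMap
    (LinearMap.ext fun f => mulL_mulL_of_inv _ _
      (fun x => (mul_comm _ _).trans (conj_chirp_mul x)) f)
    (LinearMap.ext fun f => mulL_mulL_of_inv _ _ (fun x => conj_chirp_mul x) f)
  norm_map' f := by
    rw [Lp.norm_def, Lp.norm_def]
    refine congrArg ENNReal.toReal (eLpNorm_congr_norm_ae ?_)
    filter_upwards [coeFn_mulL memLp_top_chirp f] with x hx
    refine (congrArg norm hx).trans ?_
    rw [norm_mul, norm_chirp, one_mul]

theorem coeFn_chirpL (f : L2R) : chirpL f =ᵐ[volume] fun x => chirp x * f x :=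
  coeFn_mulL memLp_top_chirp f

/-- The unitary `f ↦ 𝓕 (e^{ix²/2} f)`. -/
def diagU : L2R ≃ₗᵢ[ℂ] L2R := chirpL.trans (Lp.fourierTransformₗᵢ ℝ ℂ)

theorem diagU_apply (f : L2R) : diagU f = 𝓕 (chirpL f) := rfl

theorem fourier_toLp_derivCLM (s : 𝓢(ℝ, ℂ)) (x : ℝ) :
    𝓕 (derivCLM ℂ ℂ s) x = 2 * Real.pi * Complex.I * x * 𝓕 s x := by
  rw [fourier_coe, fourier_coe]
  have h : ⇑(derivCLM ℂ ℂ s) = deriv s := funext fun x => derivCLM_apply ℂ s x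
  have hi : Integrable (deriv s) := by
    rw [← h]; exact (derivCLM ℂ ℂ s).integrable
  rw [h, Real.fourier_deriv s.integrable s.differentiable hi]
  rfl

/-- Absolutely continuous functions are reached by duality. For a test function `k`, integration by
parts against `𝓕⁻ k` and Plancherel move the derivative onto a Schwartz function, where the Fourier
rule is known. -/
theorem fourier_deriv_of_isACRep {f : L2R} {g : ℝ → ℂ} (h : IsACRep f g) :
    (𝓕 (h.memLp_deriv.toLp : L2R) : L2R) =ᵐ[volume]
      fun x => 2 * Real.pi * Complex.I * x * (𝓕 f : L2R) x := by
  have hg2 : MemLp g 2 volume := (memLp_congr_ae h.ae_eq).1 (Lp.memLp f)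
  have key (s : 𝓢(ℝ, ℂ)) : ⟪s.toLp 2, (h.memLp_deriv.toLp : L2R)⟫_ℂ
      = -⟪(derivCLM ℂ ℂ s).toLp 2, f⟫_ℂ := by
    have hd : ⇑(derivCLM ℂ ℂ s) = deriv s := funext fun x => derivCLM_apply ℂ s x
    have hd2 : MemLp (deriv s) 2 (volume : Measure ℝ) := by
      rw [← hd]; exact (derivCLM ℂ ℂ s).memLp 2
    have := integral_conj_mul_deriv_eq_neg (s.smooth 1) (s.memLp 2) hd2 h.ac hg2 h.memLp_deriv
    rw [L2_inner_eq_integral, L2_inner_eq_integral]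
    convert this using 1
    · refine integral_congr_ae ?_
      filter_upwards [s.coeFn_toLp 2, h.memLp_deriv.coeFn_toLp] with x h1 h2
      rw [h1, h2]
    · congr 1
      refine integral_congr_ae ?_
      filter_upwards [(derivCLM ℂ ℂ s).coeFn_toLp 2, h.ae_eq] with x h1 h2
      rw [h1, h2, hd]
  refine ae_eq_of_integral_contDiff_smul_eq ?_ ?_ fun k hk hkc => ?_
  · exact (Lp.memLp _).locallyIntegrable one_le_two
  · rw [← locallyIntegrableOn_univ]
    exact (((Lp.memLp _).locallyIntegrable one_le_two).locallyIntegrableOn _).continuousOn_mul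
      (by fun_prop) isOpen_univ.isLocallyClosed
  let hs : 𝓢(ℝ, ℂ) := (hkc.comp_left (g := ((↑) : ℝ → ℂ)) rfl).toSchwartzMap
    (Complex.ofRealCLM.contDiff.comp hk)
  have hsv (x : ℝ) : hs x = (k x : ℂ) := rfl
  -- The factor `i` in the transform of `(𝓕⁻ k)'` is conjugated in the first slot, which absorbs the
  -- minus sign from integration by parts.
  have h1 := key (𝓕⁻ hs)
  have e (a b : L2R) : ⟪a, b⟫_ℂ = ⟪(𝓕 a : L2R), (𝓕 b : L2R)⟫_ℂ := (Lp.inner_fourier_eq a b).symm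
  rw [e, e _ f, toLp_fourier_eq, toLp_fourier_eq,
    fourier_fourierInv_eq, L2_inner_eq_integral, L2_inner_eq_integral, ← integral_neg] at h1
  convert h1 using 1
  · refine integral_congr_ae ?_
    filter_upwards [hs.coeFn_toLp 2] with x h1
    rw [h1, hsv, Complex.conj_ofReal, Complex.real_smul]
  · refine integral_congr_ae ?_
    filter_upwards [(𝓕 (derivCLM ℂ ℂ (𝓕⁻ hs))).coeFn_toLp 2] with x h1
    rw [h1, fourier_toLp_derivCLM, fourier_fourierInv_eq, hsv]
    simp only [map_mul, Complex.conj_ofReal, Complex.conj_I, Complex.real_smul, map_ofNat]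
    ring

/-- The product rule yields `c (i x f + f')`. Membership in the domain of `X` is what keeps this
derivative in `L²`. -/
theorem IsACRep.chirpL_add {f : L2R} {g : ℝ → ℂ} (h : IsACRep f g)
    (hX : MemLp (fun x : ℝ => (x : ℂ) * f x) 2 volume) :
    IsACRep (chirpL f) (chirp • g) ∧
      deriv (chirp • g) =ᵐ[volume] fun x => chirp x * (Complex.I * x * f x + deriv g x) := by
  have hd : deriv (chirp • g) =ᵐ[volume]
      fun x => chirp x * (Complex.I * x * f x + deriv g x) := by
    filter_upwards [h.ae_differentiableAt, h.ae_eq] with x hx hf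
    rw [((hasDerivAt_chirp x).smul hx.hasDerivAt).deriv, hf]
    simp only [smul_eq_mul]
    ring
  refine ⟨⟨?_, fun a b => ?_, ?_⟩, hd⟩
  · filter_upwards [coeFn_chirpL f, h.ae_eq] with x h1 h2
    rw [h1, h2]; rfl
  · exact contDiff_chirp.contDiffOn.absolutelyContinuousOnInterval.smul (h.ac a b)
  · refine (memLp_congr_ae hd).2 (MemLp.mul (p := ⊤) (q := 2) ?_ memLp_top_chirp)
    refine MemLp.add ?_ h.memLp_deriv
    simpa only [mul_assoc] using hX.const_mul Complex.I

theorem position_add_momentum_le :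
    position + momentum ≤ mulOp diagU fun x => ((2 * Real.pi * x : ℝ) : ℂ) := by
  have key (u : (position + momentum).domain) :
      diagU ((position + momentum) u) =ᵐ[volume]
        fun x => ((2 * Real.pi * x : ℝ) : ℂ) * diagU u x := by
    obtain ⟨f, hX, g, h⟩ := u
    obtain ⟨h1, h2⟩ := h.chirpL_add hX
    have e : chirpL ((position + momentum) ⟨f, hX, g, h⟩)
        = (-Complex.I) • (h1.memLp_deriv.toLp : L2R) := by
      have e0 : (position + momentum) ⟨f, hX, g, h⟩
          = (MemLp.toLp _ hX : L2R) + (-Complex.I) • (h.memLp_deriv.toLp : L2R) := by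
        rw [LinearPMap.add_apply, momentum_apply _ h]
        rfl
      rw [e0]
      refine Lp.ext ?_
      filter_upwards [coeFn_chirpL ((MemLp.toLp _ hX : L2R)
          + (-Complex.I) • (h.memLp_deriv.toLp : L2R)),
        Lp.coeFn_add (MemLp.toLp _ hX : L2R) ((-Complex.I) • (h.memLp_deriv.toLp : L2R)),
        Lp.coeFn_smul (-Complex.I) (h.memLp_deriv.toLp : L2R), h.memLp_deriv.coeFn_toLp,
        MemLp.coeFn_toLp hX,
        Lp.coeFn_smul (-Complex.I) (h1.memLp_deriv.toLp : L2R), h1.memLp_deriv.coeFn_toLp,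
        h2] with x a1 a2 a3 a4 a5 a6 a7 a8
      rw [a1, a2, Pi.add_apply, a3, Pi.smul_apply, a4, a5, a6, Pi.smul_apply, a7, a8]
      simp only [smul_eq_mul]
      linear_combination (x * chirp x * f x) * Complex.I_mul_I
    rw [diagU_apply, diagU_apply, e, fourier_smul]
    filter_upwards [Lp.coeFn_smul (-Complex.I) (𝓕 (h1.memLp_deriv.toLp : L2R) : L2R),
      fourier_deriv_of_isACRep h1] with x a1 a2
    rw [a1, Pi.smul_apply, a2, smul_eq_mul]
    push_cast
    linear_combination (-2 * Real.pi * x * (𝓕 (chirpL f) : L2R) x) * Complex.I_mul_I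
  refine ⟨fun u hu => (mulOp_of_ae_eq diagU (key ⟨u, hu⟩)).1, ?_⟩
  rintro u v huv
  obtain ⟨h1, h2⟩ := mulOp_of_ae_eq diagU (key u)
  rw [← h2]
  congr 1
  exact Subtype.ext huv

end Diagonalization

/-! ### The closure of `X + P` -/

section ClosureEq

open SchwartzMap FourierTransform
open scoped ContDiff

/-- For a Schwartz function `s`, the function `e^{-ix²/2} s` is in the domain of `X + P`. -/
theorem chirpL_symm_toLp_mem_domain (s : 𝓢(ℝ, ℂ)) :
    chirpL.symm (s.toLp 2) ∈ (position + momentum).domain := by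
  set f : L2R := chirpL.symm (s.toLp 2) with hf
  have hfs : f =ᵐ[volume] fun x => (starRingEnd ℂ) (chirp x) * s x := by
    have h := coeFn_chirpL f
    rw [hf, LinearIsometryEquiv.apply_symm_apply, ← hf] at h
    filter_upwards [h, s.coeFn_toLp 2] with x h1 h2
    rw [← h2, h1, ← mul_assoc, conj_chirp_mul, one_mul]
  have hcc : ContDiff ℝ 1 fun x => (starRingEnd ℂ) (chirp x) :=
    Complex.conjCLE.contDiff.comp contDiff_chirp
  have hxs : MemLp (fun x : ℝ => (x : ℂ) * s x) 2 volume := by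
    have h := (smulLeftCLM ℂ (fun x : ℝ => x) s).memLp 2 (volume : Measure ℝ)
    refine (memLp_congr_ae (ae_of_all _ fun x => ?_)).1 h
    rw [smulLeftCLM_apply_apply (by fun_prop), Complex.real_smul]
  have hd : ⇑(derivCLM ℂ ℂ s) = deriv s := funext fun x => derivCLM_apply ℂ s x
  have hs' : MemLp (deriv s) 2 (volume : Measure ℝ) := by
    rw [← hd]; exact (derivCLM ℂ ℂ s).memLp 2
  have hcs : MemLp (fun x => (starRingEnd ℂ) (chirp x)) ⊤ (volume : Measure ℝ) :=
    memLp_top_chirp.star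
  refine ⟨?_, (fun x => (starRingEnd ℂ) (chirp x)) • ⇑s, hfs, fun a b => ?_, ?_⟩
  · change MemLp (fun x : ℝ => (x : ℂ) * f x) 2 volume
    refine (memLp_congr_ae ?_).1 (MemLp.mul (p := ⊤) (q := 2) hxs hcs)
    filter_upwards [hfs] with x hx
    rw [hx, Pi.mul_apply]
    ring
  · exact hcc.contDiffOn.absolutelyContinuousOnInterval.smul
      (s.smooth 1).contDiffOn.absolutelyContinuousOnInterval
  · have : deriv ((fun x => (starRingEnd ℂ) (chirp x)) • ⇑s) = fun x =>
        (starRingEnd ℂ) (chirp x) * (-Complex.I * (x * s x) + deriv s x) := by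
      funext x
      rw [((hasDerivAt_conj_chirp x).smul (s.hasDerivAt x)).deriv]
      simp only [smul_eq_mul]
      ring
    rw [this]
    exact MemLp.mul (p := ⊤) (q := 2) ((hxs.const_mul _).add hs') hcs

/-- On the diagonal side `X + P + i` is multiplication by `2πx + i`, so each smooth compactly
supported `g` is attained; such functions are dense and `diagU` is unitary. -/
theorem dense_range_position_add_momentum :
    Dense (Set.range fun x : (position + momentum).domain =>
      (position + momentum) x + Complex.I • (x : L2R)) := by
  have h0 := diagU.symm.surjective.denseRange.dense_image diagU.symm.continuous
    (Lp.dense_hasCompactSupport_contDiff (F := ℂ) (μ := (volume : Measure ℝ))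
      (p := 2) ENNReal.ofNat_ne_top)
  refine h0.mono ?_
  rintro _ ⟨f, ⟨g, hfg, hgc, hg⟩, rfl⟩
  have hne (x : ℝ) : ((2 * Real.pi * x : ℝ) : ℂ) + Complex.I ≠ 0 := by
    intro h
    simpa using congrArg Complex.im h
  have hk : ContDiff ℝ ∞ fun x : ℝ => (((2 * Real.pi * x : ℝ) : ℂ) + Complex.I)⁻¹ * g x :=
    ContDiff.mul (ContDiff.inv ((Complex.ofRealCLM.contDiff.comp
      (contDiff_const.mul contDiff_id)).add contDiff_const) hne) hg
  -- The solution `g / (2πx + i)` is again smooth with compact support, hence Schwartz, and its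
  -- preimage under `diagU` is `e^{-ix²/2}` times a Schwartz function.
  let k : 𝓢(ℝ, ℂ) := (hgc.mul_left
    (f := fun x : ℝ => (((2 * Real.pi * x : ℝ) : ℂ) + Complex.I)⁻¹)).toSchwartzMap hk
  have hkv (x : ℝ) : k x = (((2 * Real.pi * x : ℝ) : ℂ) + Complex.I)⁻¹ * g x := rfl
  have hmem := chirpL_symm_toLp_mem_domain (𝓕⁻ k)
  refine ⟨⟨_, hmem⟩, ?_⟩
  dsimp only
  have hU : diagU (chirpL.symm ((𝓕⁻ k).toLp 2)) = k.toLp 2 (volume : Measure ℝ) := by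
    rw [diagU_apply, LinearIsometryEquiv.apply_symm_apply, toLp_fourier_eq, fourier_fourierInv_eq]
  rw [position_add_momentum_le.2
    (y := ⟨_, position_add_momentum_le.1 hmem⟩) rfl]
  refine diagU.injective (Lp.ext ?_)
  rw [map_add, map_smul, LinearIsometryEquiv.apply_symm_apply]
  have h1 := coeFn_mulOp diagU (φ := fun x => ((2 * Real.pi * x : ℝ) : ℂ))
    ⟨_, position_add_momentum_le.1 hmem⟩
  rw [hU] at h1 ⊢
  filter_upwards [h1, Lp.coeFn_add (diagU (mulOp diagU (fun x => ((2 * Real.pi * x : ℝ) : ℂ))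
    ⟨_, position_add_momentum_le.1 hmem⟩)) (Complex.I • k.toLp 2 (volume : Measure ℝ)),
    Lp.coeFn_smul Complex.I (k.toLp 2 (volume : Measure ℝ)), k.coeFn_toLp 2, hfg] with x a1 a2 a3 a4 a5
  rw [a2, Pi.add_apply, a1, a3, Pi.smul_apply, a4, a5, hkv, smul_eq_mul, ← add_mul,
    mul_inv_cancel_left₀ (hne x)]

theorem measurable_two_pi_mul : Measurable fun x : ℝ => 2 * Real.pi * x := by fun_prop

theorem positionAddMomentum_eq :
    positionAddMomentum = mulOp diagU fun x => ((2 * Real.pi * x : ℝ) : ℂ) :=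
  LinearPMap.closure_eq_of_dense_range (mulOp_isSelfAdjoint diagU measurable_two_pi_mul)
    (mulOp_isFormalAdjoint diagU _) position_add_momentum_le dense_range_position_add_momentum

end ClosureEq

/-! ### The distribution of `X + P` in the vacuum state -/

section Vacuum

open SchwartzMap FourierTransform

/-- The `L²` transform, defined by extension, agrees with the integral on `L¹ ∩ L²`: both satisfy
the same duality with Schwartz functions. Conjugates are compared because the inner product is
conjugate-linear on the left. -/
theorem fourier_toLp_ae_eq {f : ℝ → ℂ} (h1 : Integrable f) (h2 : MemLp f 2 volume) :
    (𝓕 (h2.toLp : L2R) : L2R) =ᵐ[volume] 𝓕 f := by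
  have hcont : Continuous (𝓕 f) := VectorFourier.fourierIntegral_continuous Real.continuous_fourierChar
    (by exact continuous_inner) h1
  suffices h : ∀ᵐ x, (starRingEnd ℂ) ((𝓕 (h2.toLp : L2R) : L2R) x) = (starRingEnd ℂ) (𝓕 f x) by
    filter_upwards [h] with x hx using star_injective hx
  refine ae_eq_of_integral_contDiff_smul_eq ?_ ?_ fun k hk hkc => ?_
  · exact (Lp.memLp (𝓕 (h2.toLp : L2R) : L2R)).star.locallyIntegrable one_le_two
  · exact (Complex.continuous_conj.comp hcont).locallyIntegrable
  let s : 𝓢(ℝ, ℂ) := (hkc.comp_left (g := ((↑) : ℝ → ℂ)) rfl).toSchwartzMap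
    (Complex.ofRealCLM.contDiff.comp hk)
  have hsv (x : ℝ) : s x = (k x : ℂ) := rfl
  have e : ⟪(𝓕 (h2.toLp : L2R) : L2R), s.toLp 2⟫_ℂ = ⟪(h2.toLp : L2R), (𝓕⁻ s).toLp 2⟫_ℂ := by
    have := Lp.inner_fourier_eq (h2.toLp : L2R) ((𝓕⁻ s).toLp 2 (volume : Measure ℝ))
    rwa [toLp_fourier_eq, fourier_fourierInv_eq] at this
  have e2 := VectorFourier.integral_sesq_fourierIntegral_eq_neg_flip (μ := volume) (ν := volume)
    (innerSL ℂ) (L := innerₗ ℝ) Real.continuous_fourierChar continuous_inner h1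
    (s.integrable (μ := volume))
  rw [L2_inner_eq_integral, L2_inner_eq_integral] at e
  have e3 : ∫ x, k x • (starRingEnd ℂ) ((𝓕 (h2.toLp : L2R) : L2R) x)
      = ∫ x, (starRingEnd ℂ) ((𝓕 (h2.toLp : L2R) : L2R) x) * s.toLp 2 volume x := by
    refine integral_congr_ae ?_
    filter_upwards [s.coeFn_toLp 2] with x hx
    rw [hx, hsv, Complex.real_smul, mul_comm]
  have e4 : ∫ x, k x • (starRingEnd ℂ) (𝓕 f x)
      = ∫ x, (starRingEnd ℂ) (f x) * 𝓕⁻ s x := by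
    rw [fourierInv_coe]
    convert e2 using 1
    · refine integral_congr_ae (ae_of_all _ fun x => ?_)
      simp only [innerSL_apply_apply, RCLike.inner_apply, hsv, Complex.real_smul]
      rfl
    · refine integral_congr_ae (ae_of_all _ fun x => ?_)
      simp only [innerSL_apply_apply, RCLike.inner_apply]
      rw [mul_comm, flip_innerₗ]
      rfl
  rw [e3, e4, e]
  refine integral_congr_ae ?_
  filter_upwards [(𝓕⁻ s).coeFn_toLp 2, h2.coeFn_toLp] with x a1 a2
  rw [a1, a2]

/-- The exponents add to `-(1 - i) x² / 2`, written as `-π b x²` with `b = (1 - i) / (2π)` to match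
`fourier_gaussian_pi`. -/
theorem chirp_mul_vacuumFun (x : ℝ) : chirp x * vacuumFun x
    = ((Real.pi ^ (-(1 / 4) : ℝ) : ℝ) : ℂ) *
      Complex.exp (-Real.pi * ((1 - Complex.I) / (2 * Real.pi)) * x ^ 2) := by
  have hpi : (Real.pi : ℂ) ≠ 0 := Complex.ofReal_ne_zero.2 Real.pi_ne_zero
  rw [chirp, vacuumFun]
  push_cast
  rw [mul_left_comm, ← Complex.exp_add]
  congr 2
  field_simp
  ring

theorem re_gaussian_param : ((1 - Complex.I) / (2 * Real.pi)).re = 1 / (2 * Real.pi) := by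
  have : (1 - Complex.I) / (2 * Real.pi) = (((1 / (2 * Real.pi) : ℝ)) : ℂ) * (1 - Complex.I) := by
    push_cast; ring
  rw [this, Complex.re_ofReal_mul]
  simp

theorem diagU_vacuum : diagU vacuum =ᵐ[volume] fun x : ℝ =>
    ((Real.pi ^ (-(1 / 4) : ℝ) : ℝ) : ℂ) * (1 / ((1 - Complex.I) / (2 * Real.pi)) ^ (1 / 2 : ℂ) *
      Complex.exp (-Real.pi / ((1 - Complex.I) / (2 * Real.pi)) * x ^ 2)) := by
  set b : ℂ := (1 - Complex.I) / (2 * Real.pi) with hb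
  have hbre : 0 < b.re := by rw [re_gaussian_param]; positivity
  set g : ℝ → ℂ := fun x => ((Real.pi ^ (-(1 / 4) : ℝ) : ℝ) : ℂ) *
      Complex.exp (-Real.pi * b * x ^ 2) with hg
  have hvg : chirpL vacuum =ᵐ[volume] g := by
    filter_upwards [coeFn_chirpL vacuum, memLp_vacuumFun.coeFn_toLp] with x h1 h2
    rw [h1, vacuum, h2, chirp_mul_vacuumFun]
  have h2 : MemLp g 2 volume := (memLp_congr_ae hvg).1 (Lp.memLp _)
  have h1 : Integrable g := by
    refine Integrable.const_mul ?_ _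
    have : 0 < (Real.pi * b).re := by
      rw [Complex.re_ofReal_mul]; positivity
    simpa only [neg_mul] using integrable_cexp_neg_mul_sq this
  have e : chirpL vacuum = h2.toLp := Lp.ext (hvg.trans h2.coeFn_toLp.symm)
  rw [diagU_apply, e]
  refine (fourier_toLp_ae_eq h1 h2).trans (ae_of_all _ fun x => ?_)
  have hF := congrFun (fourier_gaussian_pi hbre) x
  dsimp only
  rw [← hF, Real.fourier_eq, Real.fourier_eq, ← integral_const_mul]
  refine integral_congr_ae (ae_of_all _ fun y => ?_)
  simp only [hg, Circle.smul_def, smul_eq_mul]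
  ring

/-- The variance `(2π)⁻²` of the vacuum state in frequency space. -/
def vacuumVariance : NNReal := ((2 * NNReal.pi) ^ 2)⁻¹

theorem coe_vacuumVariance : (vacuumVariance : ℝ) = ((2 * Real.pi) ^ 2)⁻¹ := by
  simp [vacuumVariance]

/-- Since `|b| = 1 / (√2 π)`, the prefactor squares to `π^{-1/2} √2 π = √(2π)`. Since `-π / b = -π²
(1 + i)`, the exponential squares in modulus to `e^{-(2πx)²/2}`. -/
theorem norm_sq_diagU_vacuum : ∀ᵐ x : ℝ, ‖diagU vacuum x‖ ^ 2
    = ProbabilityTheory.gaussianPDFReal 0 vacuumVariance x := by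
  have hpi := Real.pi_pos
  filter_upwards [diagU_vacuum] with x hx
  set b : ℂ := (1 - Complex.I) / (2 * Real.pi) with hb
  have h1 : ‖b ^ (1 / 2 : ℂ)‖ ^ 2 = (√2 * Real.pi)⁻¹ := by
    have e : (b ^ (1 / 2 : ℂ)) ^ 2 = b := by
      have := Complex.cpow_nat_inv_pow b two_ne_zero
      simpa only [one_div, Nat.cast_ofNat] using this
    have hn : ‖(1 : ℂ) - Complex.I‖ = √2 := by
      rw [Complex.norm_eq_sqrt_sq_add_sq]
      norm_num
    rw [← norm_pow, e, hb, norm_div, hn, norm_mul, Complex.norm_real,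
      Real.norm_of_nonneg hpi.le, Complex.norm_ofNat, inv_eq_one_div,
      div_eq_div_iff (by positivity) (by positivity)]
    linear_combination Real.pi * Real.mul_self_sqrt (zero_le_two (α := ℝ))
  have h2 : ‖Complex.exp (-Real.pi / b * x ^ 2)‖ ^ 2 = Real.exp (-(2 * Real.pi * x) ^ 2 / 2) := by
    have e : -Real.pi / b * x ^ 2 = ((-(Real.pi * x) ^ 2 : ℝ) : ℂ) * (1 + Complex.I) := by
      have h0 : (1 : ℂ) - Complex.I ≠ 0 := fun h => by simpa using congrArg Complex.re h
      have hpc : (Real.pi : ℂ) ≠ 0 := Complex.ofReal_ne_zero.2 hpi.ne'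
      rw [hb]
      push_cast
      field_simp
      linear_combination (-x ^ 2 : ℂ) * Complex.I_mul_I
    rw [Complex.norm_exp, e, Complex.re_ofReal_mul, ← Real.exp_nat_mul]
    congr 1
    simp
    ring
  have h3 : (Real.pi ^ (-(1 / 4) : ℝ)) ^ 2 = (√Real.pi)⁻¹ := by
    rw [← Real.rpow_natCast, ← Real.rpow_mul hpi.le, Real.sqrt_eq_rpow, ← Real.rpow_neg hpi.le]
    norm_num
  rw [hx, norm_mul, norm_mul, norm_div, norm_one, mul_pow, mul_pow, div_pow, h1, h2,
    Complex.norm_real, Real.norm_of_nonneg (by positivity), h3,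
    ProbabilityTheory.gaussianPDFReal, coe_vacuumVariance, ← mul_assoc]
  congr 1
  · have e : 2 * Real.pi * ((2 * Real.pi) ^ 2)⁻¹ = (2 * Real.pi)⁻¹ := by field_simp
    rw [e, Real.sqrt_inv, inv_inv, Real.sqrt_mul zero_le_two]
    have h4 := Real.mul_self_sqrt hpi.le
    field_simp
    rw [sq, h4]
  · congr 1
    field_simp
    ring

theorem distribution_vacuum :
    (mulResolution diagU measurable_two_pi_mul).distribution vacuum
      = ProbabilityTheory.gaussianReal 0 1 := by
  have hv : vacuumVariance ≠ 0 := by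
    rw [← NNReal.coe_ne_zero, coe_vacuumVariance]
    exact (inv_pos.2 (by positivity)).ne'
  have h1 : (volume.withDensity fun x => ‖diagU vacuum x‖ₑ ^ 2)
      = ProbabilityTheory.gaussianReal 0 vacuumVariance := by
    rw [ProbabilityTheory.gaussianReal_of_var_ne_zero _ hv]
    refine withDensity_congr_ae ?_
    filter_upwards [norm_sq_diagU_vacuum] with x hx
    rw [ProbabilityTheory.gaussianPDF, ← hx, ENNReal.ofReal_pow (norm_nonneg _), ofReal_norm]
  rw [mulResolution_distribution, h1, ProbabilityTheory.gaussianReal_map_const_mul, mul_zero]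
  congr 1
  refine NNReal.coe_injective ?_
  rw [NNReal.coe_mul, coe_vacuumVariance]
  exact mul_inv_cancel₀ (a := (2 * Real.pi) ^ 2) (by positivity)

end Vacuum

end

theorem mainTheorem1 :
    IsSelfAdjoint positionAddMomentum ∧
    ∃ E : ResolutionOfIdentity L2R,
      E.IsSpectralResolution positionAddMomentum ∧
      (∀ E' : ResolutionOfIdentity L2R,
        E'.IsSpectralResolution positionAddMomentum → E' = E) ∧
      (∃ U : ℝ → L2R →L[ℂ] L2R,
        (∀ t : ℝ, E.IsExp t (U t)) ∧
        (∀ (t : ℝ) (T : L2R →L[ℂ] L2R), E.IsExp t T → T = U t) ∧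
        ∀ t : ℝ, ⟪vacuum, U t vacuum⟫_ℂ = Complex.exp (-(t : ℂ) ^ 2 / 2)) ∧
      E.distribution vacuum = ProbabilityTheory.gaussianReal 0 1 := by
  rw [positionAddMomentum_eq]
  refine ⟨mulOp_isSelfAdjoint diagU measurable_two_pi_mul,
    mulResolution diagU measurable_two_pi_mul, ?_, fun E' h => ?_, ?_, distribution_vacuum⟩
  · exact mulResolution_isSpectralIntegral diagU measurable_two_pi_mul Complex.measurable_ofReal
  · exact h.eq_mulResolution measurable_two_pi_mul
  · choose U hU using mulResolution_isExp diagU measurable_two_pi_mul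
    refine ⟨U, hU, fun t T hT => ?_, fun t => ?_⟩
    · ext1 u
      refine ext_inner_left ℂ fun v => ?_
      -- The domain is the whole space, so all matrix elements are prescribed and determine the
      -- operator.
      exact (hT.2 ⟨v, trivial⟩ ⟨u, trivial⟩).trans ((hU t).2 ⟨v, trivial⟩ ⟨u, trivial⟩).symm
    · have h := (hU t).2 ⟨vacuum, trivial⟩ ⟨vacuum, trivial⟩
      rw [ResolutionOfIdentity.sesqIntegral_self, distribution_vacuum] at h
      refine h.trans ?_
      have hc := ProbabilityTheory.charFun_gaussianReal (μ := 0) (v := 1) t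
      rw [charFun_apply_real] at hc
      convert hc using 1
      · refine integral_congr_ae (ae_of_all _ fun x => ?_)
        change Complex.exp _ = Complex.exp _
        congr 1
        ring
      · congr 1
        push_cast
        ring
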